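/- Graphs are finite and undirected, may have parallel edges, and have no self-loops. A walk is an alternating sequence $(v_0,f_1,v_1,\dots,f_\ell,v_\ell)$ of vertices and edges in which $f_i$ joins $v_{i-1}$ and $v_i$; its length is $\ell$. It is a path if $v_0,\dots,v_\ell$ are distinct, and a cycle if $\ell\ge 2$, $v_0=v_\ell$, the vertices $v_1,\dots,v_\ell$ are distinct, and $f_1\ne f_\ell$ (so two distinct parallel edges form a cycle of length two). A graph is connected if any two of its vertices are joined by a path, and triconnected if it has more than three vertices and remains connected after the removal of any set of at most two vertices. Let $\Gamma$ be a group in which $\alpha+\alpha=0$ for every $\alpha$, written additively (such a group is abelian). Let $G=(V,E)$ be a triconnected graph with edge labels $\psi\colon E\to\Gamma$. The label of a walk is the sum of the labels of its edges, and a walk is non-zero if its label is not $0$. Let $e_1=x_1y_1$ and $e_2=x_2y_2$ be edges of $G$ with $\{x_1,y_1\}\cap\{x_2,y_2\}=\emptyset$, and let $G'$ be the graph obtained from $G$ by removing all edges between $x_1$ and $y_1$ and all edges between $x_2$ and $y_2$. Then $G$ contains two cycles, each passing through both $e_1$ and $e_2$, with distinct labels, if and only if $G'$ contains a non-zero cycle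 of length at least three. -/

import Mathlib

namespace Graph

/-- A walk `(v₀, e₁, v₁, …, e_ℓ, v_ℓ)` from `v₀` to `v_ℓ` in a multigraph. -/
inductive Walk {α β : Type*} (G : Graph α β) : α → α → Type _
  | nil {x : α} (hx : x ∈ G.vertexSet) : Walk G x x
  | cons {x y z : α} (e : β) (h : G.IsLink e x y) (w : Walk G y z) : Walk G x z

namespace Walk

/-- The list `[v₀, v₁, …, v_ℓ]` of vertices of a walk. -/
def vertices {α β : Type*} {G : Graph α β} : {u v : α} → G.Walk u v → List α
  | u, _, nil _ => [u]
  | u, _, cons _ _ w => u :: w.vertices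

/-- The list `[e₁, …, e_ℓ]` of edges of a walk. -/
def edges {α β : Type*} {G : Graph α β} : {u v : α} → G.Walk u v → List β
  | _, _, nil _ => []
  | _, _, cons e _ w => e :: w.edges

/-- The length `ℓ` of a walk. -/
def length {α β : Type*} {G : Graph α β} {u v : α} (w : G.Walk u v) : ℕ := w.edges.length

/-- A walk is a path if its vertices `v₀, …, v_ℓ` are distinct. -/
def IsPath {α β : Type*} {G : Graph α β} {u v : α} (w : G.Walk u v) : Prop :=
  w.vertices.Nodup

/-- A closed walk is a cycle if `ℓ ≥ 2`, the vertices `v₁, …, v_ℓ` are distinct, and `e₁ ≠ e_ℓ`.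
In particular two distinct parallel edges form a cycle of length two. -/
def IsCycle {α β : Type*} {G : Graph α β} {u : α} (w : G.Walk u u) : Prop :=
  2 ≤ w.length ∧ w.vertices.tail.Nodup ∧ w.edges.head? ≠ w.edges.getLast?

/-- The label `ψ(e₁) + ⋯ + ψ(e_ℓ)` of a walk. It is meant for groups all of whose elements are
self-inverse, where the direction in which an edge is traversed does not matter. -/
def label {α β : Type*} {G : Graph α β} {Γ : Type*} [AddGroup Γ] (ψ : β → Γ) {u v : α}
    (w : G.Walk u v) : Γ :=
  (w.edges.map ψ).sum

end Walk

/-- Any two vertices are joined by a path. -/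
def IsConnected {α β : Type*} (G : Graph α β) : Prop :=
  ∀ s ∈ G.vertexSet, ∀ t ∈ G.vertexSet, ∃ P : G.Walk s t, P.IsPath

/-- A `k`-cut: a set of at most `k` vertices whose removal leaves a disconnected graph. -/
def IsVertexCut {α β : Type*} (G : Graph α β) (k : ℕ) (X : Set α) : Prop :=
  X ⊆ G.vertexSet ∧ X.encard ≤ k ∧ ¬ (G.deleteVerts X).IsConnected

/-- `k`-connectivity (for `k ≥ 2`): more than `k` vertices and no `(k - 1)`-cut. -/
def IsKConnected {α β : Type*} (G : Graph α β) (k : ℕ) : Prop :=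
  (k : ℕ∞) < G.vertexSet.encard ∧ ∀ X : Set α, ¬ G.IsVertexCut (k - 1) X

/-- Triconnected means `3`-connected. -/
def IsTriconnected {α β : Type*} (G : Graph α β) : Prop := G.IsKConnected 3

/-- The graph obtained from `G` by removing every edge between `x₁` and `y₁` and every edge
between `x₂` and `y₂`. -/
def deleteParallel {α β : Type*} (G : Graph α β) (x₁ y₁ x₂ y₂ : α) : Graph α β :=
  G.deleteEdges {e | G.IsLink e x₁ y₁ ∨ G.IsLink e x₂ y₂}

end Graph

/-! Since `Γ` has exponent two, it is a vector space over `ZMod 2`, and a homomorphism to `ZMod 2`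
detects any given non-zero element. Each direction therefore reduces to labels in `ZMod 2`, and a
multigraph may be replaced by the relation recording which labels occur between two vertices. A
cycle through both edges is a linkage closed up by them: two disjoint paths joining the ends of one
edge to the ends of the other, in either pairing. Disjointness keeps a linkage clear of the removed
edges. The claim becomes: all linkages of `G'` have the same label iff `G'` has no non-zero cycle of
length at least three.

Suppose there is no such cycle. Between vertices without parallel links of different labels, path
labels depend only on the ends (`IsLPath.uniqueLinks_label`). A link with a parallel of the other
label would have to be a bridge of the simple graph underlying `G'`; if it lay on a linkage, two
edges would separate `G` up to parallels, against triconnectivity (`TwoEdges.not_parallel`). So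
linkages use only unambiguous links, and their labels agree.

Suppose all linkages have the same label. Menger's theorem yields a linkage `P`, `Q`, and switching
labels by a vertex potential makes all of its links zero, hence the common label zero. Rerouting
shows that ears on `P` or on `Q` are zero. Disjoint rungs between `P` and `Q` have equal labels:
this rests on `TwoEdges.linkConst_eq_zero`, where three disjoint paths, any two of which sum to `c`,
force `c = 0`. Triconnectivity then excludes forks, that is, rungs of different labels sharing just
one end (`ZeroLinkage.no_fork`). A non-zero cycle, connected to `P ∪ Q` by disjoint paths where
necessary, would produce a non-zero ear, a fork, or disjoint rungs with different labels. -/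

/-! ### Labelled paths -/

/-- `IsLPath L A u v g`: there is a path from `u` to `v` with vertex set `A` and label `g` along
the labelled adjacency relation `L`. -/
inductive IsLPath {V : Type*} (L : V → V → ZMod 2 → Prop) : Set V → V → V → ZMod 2 → Prop
  | nil (x : V) : IsLPath L {x} x x 0
  | cons {A : Set V} {x y z : V} {g h : ZMod 2} : L x y g → x ∉ A → IsLPath L A y z h →
      IsLPath L (insert x A) x z (g + h)

/-- The labelled relation `L` is symmetric. -/
def LSymm {V : Type*} (L : V → V → ZMod 2 → Prop) : Prop := ∀ ⦃u v g⦄, L u v g → L v u g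

namespace IsLPath

variable {V : Type*} {L L' : V → V → ZMod 2 → Prop} {A B X Y : Set V} {u v w x y : V}
  {g h : ZMod 2}

theorem start_mem (hp : IsLPath L A u v g) : u ∈ A := by
  cases hp <;> simp

theorem end_mem (hp : IsLPath L A u v g) : v ∈ A := by
  induction hp with
  | nil => simp
  | cons _ _ _ ih => exact Or.inr ih

theorem finite (hp : IsLPath L A u v g) : A.Finite := by
  induction hp with
  | nil => simp
  | cons _ _ _ ih => exact ih.insert _

theorem mono (hp : IsLPath L A u v g)
    (hL : ∀ u ∈ A, ∀ v ∈ A, ∀ g, L u v g → L' u v g) : IsLPath L' A u v g := by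
  induction hp with
  | nil => exact nil _
  | cons hl hx hp ih =>
    refine cons (hL _ (by simp) _ (by simp [hp.start_mem]) _ hl) hx (ih ?_)
    intro a ha b hb
    exact hL a (by simp [ha]) b (by simp [hb])

theorem mono' (hp : IsLPath L A u v g) (hL : ∀ u v g, L u v g → L' u v g) :
    IsLPath L' A u v g :=
  hp.mono fun a _ b _ => hL a b

theorem eq_nil (hp : IsLPath L A u u g) : A = {u} ∧ g = 0 := by
  generalize hv : u = v at hp
  cases hp with
  | nil => simp
  | cons hl hx hp => exact absurd (hv ▸ hp.end_mem) hx

theorem single (hl : L u v g) (huv : u ≠ v) : IsLPath L {u, v} u v g := by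
  have := cons (L := L) (A := {v}) hl (by simpa using huv) (nil v)
  simpa using this

theorem trans (hp : IsLPath L A u w g) (hq : IsLPath L B w v h)
    (hAB : ∀ x ∈ A, x ∈ B → x = w) : IsLPath L (A ∪ B) u v (g + h) := by
  induction hp with
  | nil x =>
    have : ({x} : Set V) ∪ B = B := by
      have := hq.start_mem
      ext; grind
    simpa [this] using hq
  | @cons A x y z g g' hl hx hp ih =>
    have h1 := ih hq (fun a ha => hAB a (by simp [ha]))
    have h2 : x ∉ A ∪ B := by
      have := hp.end_mem
      have := hAB x (by simp)
      grind
    have h3 := cons hl h2 h1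
    rwa [← Set.insert_union, ← add_assoc] at h3

theorem symm (hL : LSymm L) (hp : IsLPath L A u v g) : IsLPath L A v u g := by
  induction hp with
  | nil x => exact nil x
  | @cons A x y z g g' hl hx hp ih =>
    have hy := hp.start_mem
    have h1 := ih.trans (single (hL hl) (by grind)) (by grind)
    have h2 : A ∪ {y, x} = insert x A := by ext; grind
    rwa [h2, add_comm] at h1

/-- A path can be split at each of its vertices. -/
theorem split (hp : IsLPath L A u v g) (hw : w ∈ A) :
    ∃ A₁ A₂ g₁ g₂, IsLPath L A₁ u w g₁ ∧ IsLPath L A₂ w v g₂ ∧ (∀ x, x ∈ A ↔ x ∈ A₁ ∨ x ∈ A₂) ∧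
      (∀ x ∈ A₁, x ∈ A₂ → x = w) ∧ g = g₁ + g₂ := by
  induction hp with
  | nil x =>
    obtain rfl : w = x := hw
    exact ⟨{w}, {w}, 0, 0, nil w, nil w, by simp, by simp, by simp⟩
  | @cons A x y z g g' hl hx hp ih =>
    by_cases hwx : w = x
    · subst hwx
      exact ⟨{w}, insert w A, 0, g + g', nil w, cons hl hx hp, by grind, by simp, by simp⟩
    · obtain ⟨A₁, A₂, g₁, g₂, h1, h2, h3, h4, h5⟩ := ih (by grind)
      refine ⟨insert x A₁, A₂, g + g₁, g₂, cons hl (by grind) h1, h2, by grind, ?_, by grind⟩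
      grind

/-- A path meeting `X` has an initial segment that meets `X` exactly in its last vertex. -/
theorem first_hit (hp : IsLPath L A u v g) (hw : w ∈ A) (hX : w ∈ X) :
    ∃ z A₁ A₂ g₁ g₂, IsLPath L A₁ u z g₁ ∧ IsLPath L A₂ z v g₂ ∧ (∀ x, x ∈ A ↔ x ∈ A₁ ∨ x ∈ A₂) ∧
      (∀ x ∈ A₁, x ∈ A₂ → x = z) ∧ g = g₁ + g₂ ∧ z ∈ X ∧ ∀ x ∈ A₁, x ∈ X → x = z := by
  induction hp with
  | nil x =>
    obtain rfl : w = x := hw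
    exact ⟨w, {w}, {w}, 0, 0, nil w, nil w, by simp, by simp, by simp, hX, by simp⟩
  | @cons A x y z g g' hl hx hp ih =>
    by_cases hxX : x ∈ X
    · exact ⟨x, {x}, insert x A, 0, g + g', nil x, cons hl hx hp, by grind, by simp, by simp,
        hxX, by simp⟩
    · obtain ⟨z', A₁, A₂, g₁, g₂, h1, h2, h3, h4, h5, h6, h7⟩ := ih (by grind)
      exact ⟨z', insert x A₁, A₂, g + g₁, g₂, cons hl (by grind) h1, h2, by grind, by grind,
        by grind, h6, by grind⟩

/-- A path from `X` to `Y` contains a path meeting `X` only in its start and `Y` only in its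
end. -/
theorem shorten (hL : LSymm L) (hp : IsLPath L A u v g) (hu : u ∈ X) (hv : v ∈ Y) :
    ∃ s t B h, IsLPath L B s t h ∧ (∀ x ∈ B, x ∈ A) ∧ s ∈ X ∧ t ∈ Y ∧ (∀ x ∈ B, x ∈ X → x = s) ∧
      (∀ x ∈ B, x ∈ Y → x = t) := by
  obtain ⟨t, A₁, A₂, g₁, g₂, h1, -, h3, -, -, h6, h7⟩ := hp.first_hit hp.end_mem hv
  obtain ⟨s, B₁, B₂, g₃, g₄, k1, -, k3, -, -, k6, k7⟩ :=
    (h1.symm hL).first_hit h1.start_mem hu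
  exact ⟨s, t, B₁, g₃, k1.symm hL, by grind, k6, h6, k7, by grind⟩

/-- Two walks can be concatenated to a path, if the label does not matter. -/
theorem concat (hp : IsLPath L A u w g) (hq : IsLPath L B w v h) :
    ∃ C k, IsLPath L C u v k ∧ ∀ x ∈ C, x ∈ A ∨ x ∈ B := by
  induction hp with
  | nil x => exact ⟨B, h, hq, by grind⟩
  | @cons A x y z g g' hl hx hp ih =>
    obtain ⟨C, k, hC, hsub⟩ := ih hq
    by_cases hxC : x ∈ C
    · obtain ⟨C₁, C₂, g₁, g₂, -, h2, h3, -, -⟩ := hC.split hxC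
      exact ⟨C₂, g₂, h2, by grind⟩
    · exact ⟨insert x C, g + k, cons hl hxC hC, by grind⟩

/-- A path between two vertices with no further vertex is a link. -/
theorem link_of_forall (hp : IsLPath L A u v g) (huv : u ≠ v) (hA : ∀ x ∈ A, x = u ∨ x = v) :
    L u v g := by
  cases hp with
  | nil => exact absurd rfl huv
  | @cons A _ y _ g g' hl hx hp =>
    obtain rfl : y = v := by have := hA y (by simp [hp.start_mem]); have := hp.start_mem; grind
    obtain ⟨-, rfl⟩ := hp.eq_nil
    simpa using hl

end IsLPath

theorem ZMod.two_eq_add_one_of_ne {a b : ZMod 2} (h : a ≠ b) : a = b + 1 := by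
  revert a b; decide

/-! ### Menger's theorem -/

/-- The relation `L` after removing all links between `x` and `y`. -/
def delLinks {V : Type*} (L : V → V → ZMod 2 → Prop) (x y : V) : V → V → ZMod 2 → Prop :=
  fun u v g => L u v g ∧ ¬ (u = x ∧ v = y) ∧ ¬ (u = y ∧ v = x)

/-- Every path from `A` to `B` meets `X`. -/
def Separates {V : Type*} (L : V → V → ZMod 2 → Prop) (A B X : Set V) : Prop :=
  ∀ D a b g, IsLPath L D a b g → a ∈ A → b ∈ B → ∃ x ∈ D, x ∈ X

/-- There are `k` pairwise disjoint paths from `A` to `B`. -/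
def HasDisjointPaths {V : Type*} (L : V → V → ZMod 2 → Prop) (A B : Set V) (k : ℕ) : Prop :=
  ∃ (D : Fin k → Set V) (s t : Fin k → V) (g : Fin k → ZMod 2),
    (∀ i, IsLPath L (D i) (s i) (t i) (g i) ∧ s i ∈ A ∧ t i ∈ B) ∧
      ∀ i j, i ≠ j → ∀ x ∈ D i, x ∉ D j

section Menger

variable {V : Type*} {L : V → V → ZMod 2 → Prop} {A B S W : Set V} {x y : V} {k : ℕ}

theorem LSymm.delLinks (hL : LSymm L) (x y : V) : LSymm (delLinks L x y) :=
  fun u v g h => ⟨hL h.1, by have := h.2; grind⟩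

theorem delLinks_comm : delLinks L x y = delLinks L y x := by
  ext; simp only [delLinks]; tauto

theorem IsLPath.delLinks {D : Set V} {a b : V} {g : ZMod 2} (hp : IsLPath L D a b g)
    (h : x ∉ D ∨ y ∉ D) : IsLPath (delLinks L x y) D a b g :=
  hp.mono fun u hu v hv g hg => ⟨hg, by grind, by grind⟩

theorem Separates.comm (hL : LSymm L) (h : Separates L A B S) : Separates L B A S :=
  fun D a b g hp ha hb => h D b a g (hp.symm hL) hb ha

/-- An `A`–`B` path avoiding `W` has an initial segment up to its first vertex in `insert x S`. This
segment could escape `W` only by using the deleted link from `y` to `x`; but then the part up to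
`y`, continued from `y` to `B`, avoids `S` without that link. -/
theorem Separates.of_delLinks (hxy : x ≠ y) (hS : Separates (delLinks L x y) A B S)
    (hy : ∃ D b g, b ∈ B ∧ IsLPath (delLinks L x y) D y b g ∧ ∀ v ∈ D, v ∉ S)
    (hW : Separates (delLinks L x y) A (insert x S) W) : Separates L A B W := by
  intro D a b g hp ha hb
  by_contra! hD
  have hhit : ∃ v ∈ D, v ∈ insert x S := by
    by_contra! hc
    obtain ⟨v, hv, hvS⟩ := hS D a b g (hp.delLinks (by grind)) ha hb
    grind
  obtain ⟨v, hv, hvX⟩ := hhit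
  obtain ⟨z, A₁, A₂, g₁, g₂, h1, -, h3, -, -, h6, h7⟩ := hp.first_hit hv hvX
  by_cases hz : z = x ∧ y ∈ A₁
  · obtain ⟨rfl, hyA⟩ := hz
    obtain ⟨A₃, A₄, g₃, g₄, k1, k2, k3, k4, -⟩ := h1.split hyA
    obtain ⟨E, c, e, hc, hE, hES⟩ := hy
    have hz3 : z ∉ A₃ := by have := k2.end_mem; grind
    obtain ⟨C, k, hC, hsub⟩ := (k1.delLinks (x := z) (y := y) (.inl hz3)).concat hE
    obtain ⟨w, hw, hwS⟩ := hS C a c k hC ha hc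
    grind
  · obtain ⟨w, hw, hwW⟩ := hW A₁ a z g₁ (h1.delLinks (by have := h1.end_mem; grind)) ha h6
    grind

/-- When the target has exactly `k` vertices, every one of them is the end of a path, so the paths
can be indexed by their ends. -/
theorem HasDisjointPaths.onto [Finite V] (hL : LSymm L) {X : Set V}
    (h : HasDisjointPaths L A X k) (hX : X.ncard = k) :
    ∃ (D : V → Set V) (s : V → V) (g : V → ZMod 2),
      (∀ z ∈ X, IsLPath L (D z) (s z) z (g z) ∧ s z ∈ A ∧ ∀ x ∈ D z, x ∈ X → x = z) ∧
      ∀ z ∈ X, ∀ z' ∈ X, z ≠ z' → ∀ x ∈ D z, x ∉ D z' := by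
  classical
  obtain ⟨D, s, t, g, h1, h2⟩ := h
  choose s' t' D' g' k1 k2 k3 k4 _ k6 using fun i => (h1 i).1.shorten hL (h1 i).2.1 (h1 i).2.2
  have hdisj : ∀ i j, i ≠ j → ∀ x ∈ D' i, x ∉ D' j := fun i j hij x hx hx' =>
    h2 i j hij x (k2 i x hx) (k2 j x hx')
  have hinj : Function.Injective t' := by
    intro i j hij
    by_contra hne
    exact hdisj i j hne (t' i) (k1 i).end_mem (hij ▸ (k1 j).end_mem)
  have hrange : Set.range t' = X := by
    apply Set.eq_of_subset_of_ncard_le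
    · rintro _ ⟨i, rfl⟩; exact k4 i
    · rw [hX, ← Set.image_univ, Set.ncard_image_of_injective _ hinj, Set.ncard_univ]; simp
    · exact Set.toFinite _
  have hex : ∀ z : V, ∃ D s g, z ∈ X → ∃ i, t' i = z ∧ D = D' i ∧ s = s' i ∧ g = g' i := by
    intro z
    by_cases hz : z ∈ X
    · obtain ⟨i, hi⟩ := hrange ▸ hz
      exact ⟨_, _, _, fun _ => ⟨i, hi, rfl, rfl, rfl⟩⟩
    · exact ⟨∅, z, 0, fun h => absurd h hz⟩
  choose E e f hE using hex
  refine ⟨E, e, f, fun z hz => ?_, fun z hz z' hz' hne => ?_⟩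
  · obtain ⟨i, rfl, h3, h4, h5⟩ := hE z hz
    rw [h3, h4, h5]
    exact ⟨k1 i, k3 i, k6 i⟩
  · obtain ⟨i, rfl, h3, -, -⟩ := hE z hz
    obtain ⟨j, rfl, h4, -, -⟩ := hE z' hz'
    rw [h3, h4]
    exact hdisj i j (by rintro rfl; exact hne rfl)

/-- Menger's theorem for vertex-disjoint paths between two sets. -/
theorem menger [Finite V] (hL : LSymm L) (hirr : ∀ u g, ¬ L u u g)
    (hk : ∀ X, Separates L A B X → k ≤ X.ncard) : HasDisjointPaths L A B k := by
  induction hn : {p : V × V | ∃ g, L p.1 p.2 g}.ncard using Nat.strong_induction_on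
    generalizing L A B with
  | _ n ih =>
  subst hn
  by_cases hempty : ∀ u v g, ¬ L u v g
  · have h1 : k ≤ (A ∩ B).ncard := by
      apply hk
      intro D a b g hp ha hb
      cases hp with
      | nil => exact ⟨a, rfl, ha, hb⟩
      | cons hl => exact absurd hl (hempty _ _ _)
    obtain ⟨T, hT, hTk⟩ := Set.exists_subset_card_eq h1
    have e : Fin k ≃ T := (Finite.equivFinOfCardEq (by simpa using hTk)).symm
    refine ⟨fun i => {(e i : V)}, fun i => e i, fun i => e i, fun _ => 0, fun i => ⟨.nil _, ?_⟩, ?_⟩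
    · exact hT (e i).2
    · intro i j hij x hx hx'
      exact hij (e.injective (Subtype.ext (by rw [← hx, ← hx'])))
  · push Not at hempty
    obtain ⟨x, y, g, hl⟩ := hempty
    have hxy : x ≠ y := by rintro rfl; exact hirr _ _ hl
    have hcard : {p : V × V | ∃ g, delLinks L x y p.1 p.2 g}.ncard <
        {p : V × V | ∃ g, L p.1 p.2 g}.ncard := by
      apply Set.ncard_lt_ncard _ (Set.toFinite _)
      refine ⟨fun p ⟨g, hg⟩ => ⟨g, hg.1⟩, fun h => ?_⟩
      obtain ⟨g, hg⟩ := h (a := (x, y)) ⟨g, hl⟩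
      exact hg.2.1 ⟨rfl, rfl⟩
    have hL' := hL.delLinks x y
    have hirr' : ∀ u g, ¬ delLinks L x y u u g := fun u g h => hirr u g h.1
    by_cases hsep : ∀ X, Separates (delLinks L x y) A B X → k ≤ X.ncard
    · obtain ⟨D, s, t, g, h1, h2⟩ := ih _ hcard hL' hirr' hsep rfl
      exact ⟨D, s, t, g, fun i => ⟨(h1 i).1.mono' fun _ _ _ h => h.1, (h1 i).2⟩, h2⟩
    push Not at hsep
    obtain ⟨S, hS, hSk⟩ := hsep
    -- A set `S` with fewer than `k` vertices separates only after the links between `x` and `y` are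
    -- deleted. The induction supplies paths from `A` to `S` with `x` and from `B` to `S` with `y`,
    -- to be glued along `S` and the link. The orientation is left open because the path avoiding
    -- `S` may traverse the link either way.
    have key : ∀ x y g, L x y g → x ≠ y → LSymm (delLinks L x y) →
        (∀ A' B', (∀ X, Separates (delLinks L x y) A' B' X → k ≤ X.ncard) →
          HasDisjointPaths (delLinks L x y) A' B' k) →
        Separates (delLinks L x y) A B S →
        (∃ D a g, a ∈ A ∧ IsLPath (delLinks L x y) D x a g ∧ ∀ v ∈ D, v ∉ S) →
        (∃ D b g, b ∈ B ∧ IsLPath (delLinks L x y) D y b g ∧ ∀ v ∈ D, v ∉ S) →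
        HasDisjointPaths L A B k := by
      clear * - hL hk hSk
      classical
      intro x y g hl hxy hL' ih hS hx hy
      have hxS : x ∉ S := by
        obtain ⟨D, a, g, -, hp, hD⟩ := hx
        exact hD x hp.start_mem
      have hyS : y ∉ S := by
        obtain ⟨D, a, g, -, hp, hD⟩ := hy
        exact hD y hp.start_mem
      have hcx : (insert x S).ncard = k := by
        have := Set.ncard_insert_le x S
        have : k ≤ (insert x S).ncard := by
          refine hk _ fun D a b g hp ha hb => ?_
          by_cases hxD : x ∈ D
          · exact ⟨x, hxD, by simp⟩
          · obtain ⟨v, hv, hvS⟩ := hS D a b g (hp.delLinks (.inl hxD)) ha hb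
            exact ⟨v, hv, by simp [hvS]⟩
        omega
      have hcy : (insert y S).ncard = k := by
        rw [Set.ncard_insert_of_notMem hyS]
        rwa [Set.ncard_insert_of_notMem hxS] at hcx
      obtain ⟨P, s, p, hP, hPd⟩ := (ih A (insert x S)
        fun X hX => hk X (hS.of_delLinks hxy hy hX)).onto hL' hcx
      obtain ⟨Q, t, q, hQ, hQd⟩ := (ih B (insert y S)
        fun X hX => hk X <| Separates.comm hL <| by
          rw [delLinks_comm] at hX hS hx hL'
          exact (hS.comm hL').of_delLinks hxy.symm hx hX).onto hL' hcy
      -- A meeting point outside `S` would yield an `A`–`B` path that avoids `S` and the deleted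
      -- links.
      have hPQ : ∀ z ∈ insert x S, ∀ z' ∈ insert y S, ∀ v ∈ P z, v ∈ Q z' →
          v ∈ S ∧ v = z ∧ v = z' := by
        intro z hz z' hz' v hv hv'
        obtain ⟨h1, h2, h3⟩ := hP z hz
        obtain ⟨k1, k2, k3⟩ := hQ z' hz'
        have hvS : v ∈ S := by
          by_contra hvS
          obtain ⟨C₁, C₂, c₁, c₂, l1, l2, l3, l4, -⟩ := h1.split hv
          obtain ⟨D₁, D₂, d₁, d₂, m1, m2, m3, m4, -⟩ := k1.split hv'
          obtain ⟨C, c, hC, hsub⟩ := l1.concat (m1.symm hL')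
          obtain ⟨w, hw, hwS⟩ := hS C _ _ c hC h2 k2
          have := l2.end_mem
          have := m2.end_mem
          grind
        grind
      have hjoin : ∀ z : ↥(insert x S), ∃ D s t g, IsLPath L D s t g ∧ s ∈ A ∧ t ∈ B ∧
          ∀ v ∈ D, v ∈ P z ∨ v ∈ Q (if z = x then y else z) := by
        rintro ⟨z, hz⟩
        have hP1 := (hP z hz).1.mono' (L' := L) fun _ _ _ h => h.1
        by_cases hzx : z = x
        · subst hzx
          have hQ1 := ((hQ y (by simp)).1.mono' (L' := L) fun _ _ _ h => h.1).symm hL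
          have h2 := hP1.trans (IsLPath.single hl hxy) (by
            have := hQ1.start_mem
            have := hPQ z hz y (by simp) y
            grind)
          have h3 := h2.trans hQ1 (by
            have := hPQ z hz y (by simp)
            have := hP1.end_mem
            grind)
          exact ⟨_, _, _, _, h3, (hP z hz).2.1, (hQ y (by simp)).2.1, by
            have := hQ1.start_mem
            have := hP1.end_mem
            grind⟩
        · have hzS : z ∈ insert y S := by grind
          have hQ1 := ((hQ z hzS).1.mono' (L' := L) fun _ _ _ h => h.1).symm hL
          have h2 := hP1.trans hQ1 (by
            have := hPQ z hz z hzS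
            grind)
          exact ⟨_, _, _, _, h2, (hP z hz).2.1, (hQ z hzS).2.1, by grind⟩
      choose D s t g h1 h2 h3 h4 using hjoin
      have e : Fin k ≃ ↥(insert x S) := (Finite.equivFinOfCardEq (by simpa using hcx)).symm
      refine ⟨fun i => D (e i), fun i => s (e i), fun i => t (e i), fun i => g (e i),
        fun i => ⟨h1 _, h2 _, h3 _⟩, fun i j hij v hv hv' => ?_⟩
      have hne : (e i : V) ≠ e j := fun h => hij (e.injective (Subtype.ext h))
      have hi := h4 _ v hv
      have hj := h4 _ v hv'
      have hei := (e i).2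
      have hej := (e j).2
      generalize (e i : V) = z at *
      generalize (e j : V) = z' at *
      have hQz : (if z = x then y else z) ∈ insert y S := by grind
      have hQz' : (if z' = x then y else z') ∈ insert y S := by grind
      have c1 := hPd z hei z' hej hne v
      have c2 := hQd _ hQz _ hQz' (by grind) v
      have c3 := hPQ z hei _ hQz' v
      have c4 := hPQ z' hej _ hQz v
      grind
    have hnS : ¬ Separates L A B S := fun h => absurd (hk S h) (by omega)
    unfold Separates at hnS
    push Not at hnS
    obtain ⟨D, a, b, e, hp, ha, hb, hD⟩ := hnS
    have ihL := fun A' B' h => ih _ hcard (A := A') (B := B') hL' hirr' h rfl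
    have hxD : x ∈ D := by
      by_contra hxD
      obtain ⟨v, hv, hvS⟩ := hS D a b e (hp.delLinks (.inl hxD)) ha hb
      exact hD v hv hvS
    have hyD : y ∈ D := by
      by_contra hyD
      obtain ⟨v, hv, hvS⟩ := hS D a b e (hp.delLinks (.inr hyD)) ha hb
      exact hD v hv hvS
    obtain ⟨D₁, D₂, g₁, g₂, h1, h2, h3, h4, -⟩ := hp.split hxD
    by_cases hyD₁ : y ∈ D₁
    · obtain ⟨D₃, D₄, g₃, g₄, k1, k2, k3, k4, -⟩ := h1.split hyD₁
      rw [delLinks_comm] at hL' ihL hS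
      refine key y x g (hL hl) hxy.symm hL' ihL hS
        ⟨D₃, a, g₃, ha, (k1.delLinks (.inr ?_)).symm hL', by grind⟩
        ⟨D₂, b, g₂, hb, h2.delLinks (.inl ?_), by grind⟩
      · have := k2.end_mem
        grind
      · grind
    · obtain ⟨D₃, D₄, g₃, g₄, k1, k2, k3, k4, -⟩ := h2.split (w := y) (by grind)
      refine key x y g hl hxy hL' ihL hS
        ⟨D₁, a, g₁, ha, (h1.delLinks (.inr ?_)).symm hL', by grind⟩
        ⟨D₄, b, g₄, hb, k2.delLinks (.inl ?_), by grind⟩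
      · grind
      · have := k1.start_mem
        grind

end Menger

/-! ### Zero links and switching by a potential -/

/-- The links of `L` with label zero. -/
def zeroLinks {V : Type*} (L : V → V → ZMod 2 → Prop) : V → V → ZMod 2 → Prop :=
  fun u v g => L u v g ∧ g = 0

/-- The relation `L` with labels switched by the potential `π`. -/
def switched {V : Type*} (L : V → V → ZMod 2 → Prop) (π : V → ZMod 2) :
    V → V → ZMod 2 → Prop :=
  fun u v g => L u v (g + π u + π v)

/-- The path with vertex set `A` passes through `u`, `a`, `b`, `v` in this order. -/
def Split3 {V : Type*} (L : V → V → ZMod 2 → Prop) (A : Set V) (u a b v : V) (g : ZMod 2) :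
    Prop :=
  ∃ A₁ A₂ A₃ g₁ g₂ g₃, IsLPath L A₁ u a g₁ ∧ IsLPath L A₂ a b g₂ ∧ IsLPath L A₃ b v g₃ ∧
    (∀ x, x ∈ A ↔ x ∈ A₁ ∨ x ∈ A₂ ∨ x ∈ A₃) ∧ (∀ x ∈ A₁, x ∈ A₂ → x = a) ∧
    (∀ x ∈ A₂, x ∈ A₃ → x = b) ∧ (∀ x ∈ A₁, x ∉ A₃) ∧ g = g₁ + g₂ + g₃

section Switching

variable {V : Type*} {L : V → V → ZMod 2 → Prop} {A : Set V} {u v a b : V} {g : ZMod 2}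
  {π : V → ZMod 2}

theorem IsLPath.split3 (hp : IsLPath L A u v g) (ha : a ∈ A) (hb : b ∈ A) (hab : a ≠ b) :
    Split3 L A u a b v g ∨ Split3 L A u b a v g := by
  obtain ⟨A₁, A₂, g₁, g₂, h1, h2, h3, h4, h5⟩ := hp.split ha
  rcases (h3 b).1 hb with hb | hb
  · obtain ⟨B₁, B₂, k₁, k₂, l1, l2, l3, l4, l5⟩ := h1.split hb
    have := l2.end_mem
    exact .inr ⟨B₁, B₂, A₂, k₁, k₂, g₂, l1, l2, h2, by grind, by grind, by grind, by grind,
      by grind⟩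
  · obtain ⟨B₁, B₂, k₁, k₂, l1, l2, l3, l4, l5⟩ := h2.split hb
    have := l1.start_mem
    exact .inl ⟨A₁, B₁, B₂, g₁, k₁, k₂, h1, l1, l2, by grind, by grind, by grind, by grind,
      by grind⟩

theorem zeroLinks_label (hp : IsLPath (zeroLinks L) A u v g) : g = 0 := by
  induction hp with
  | nil => rfl
  | cons hl _ _ ih => rw [hl.2, ih, add_zero]

theorem zeroLinks_path (hp : IsLPath (zeroLinks L) A u v g) : IsLPath L A u v 0 := by
  have := zeroLinks_label hp
  subst this
  exact hp.mono' fun _ _ _ h => h.1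

theorem LSymm.zeroLinks (hL : LSymm L) : LSymm (zeroLinks L) := fun _ _ _ h => ⟨hL h.1, h.2⟩

theorem LSymm.switched (hL : LSymm L) (π : V → ZMod 2) : LSymm (switched L π) := by
  intro u v g h
  have := hL h
  rwa [add_right_comm] at this

theorem switched_switched (π : V → ZMod 2) : switched (switched L π) π = L := by
  ext u v g
  have : g + π u + π v + π u + π v = g := by grind
  simp [switched, this]

theorem IsLPath.switched (hp : IsLPath L A u v g) (π : V → ZMod 2) :
    IsLPath (switched L π) A u v (g + π u + π v) := by
  induction hp with
  | nil x =>
    have : (0 : ZMod 2) + π x + π x = 0 := by grind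
    rw [this]
    exact .nil x
  | @cons A x y z g g' hl hx hp ih =>
    have h1 : _root_.switched L π x y (g + π x + π y) := by
      have : g + π x + π y + π x + π y = g := by grind
      simpa [_root_.switched, this] using hl
    have h2 := cons h1 hx ih
    have : g + π x + π y + (g' + π y + π z) = g + g' + π x + π z := by grind
    rwa [this] at h2

theorem IsLPath.of_switched (hp : IsLPath (_root_.switched L π) A u v g) :
    IsLPath L A u v (g + π u + π v) := by
  have := hp.switched π
  rwa [switched_switched] at this

/-- A potential prescribed outside a path and at its start extends to a potential for which all
links of the path have label zero. -/
theorem IsLPath.exists_potential (hp : IsLPath L A u v g) (π₀ : V → ZMod 2) :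
    ∃ π : V → ZMod 2, (∀ w, w ∉ A ∨ w = u → π w = π₀ w) ∧
      ∀ π' : V → ZMod 2, (∀ w ∈ A, π' w = π w) →
        IsLPath (zeroLinks (_root_.switched L π')) A u v 0 ∧ g = π' u + π' v := by
  classical
  induction hp generalizing π₀ with
  | nil x => exact ⟨π₀, by simp, fun _ _ => ⟨.nil x, by grind⟩⟩
  | @cons A x y z g g' hl hx hp ih =>
    -- The value at `y` is the one that makes the first link zero after switching.
    obtain ⟨π, h1, h2⟩ := ih (Function.update π₀ y (π₀ x + g))
    have hy := hp.start_mem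
    have hπy := h1 y (.inr rfl)
    have hπx := h1 x (.inl hx)
    rw [Function.update_self] at hπy
    rw [Function.update_of_ne (by grind)] at hπx
    refine ⟨π, fun w hw => ?_, fun π' hπ' => ?_⟩
    · rcases hw with hw | rfl
      · rw [h1 w (.inl (by grind)), Function.update_of_ne (by grind)]
      · exact hπx
    · have hxy : 0 + π' x + π' y = g := by
        rw [hπ' x (by simp), hπ' y (by simp [hy]), hπx, hπy]; grind
      have h3 : zeroLinks (_root_.switched L π') x y 0 := by
        refine ⟨?_, rfl⟩
        rw [_root_.switched, hxy]
        exact hl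
      obtain ⟨h4, h5⟩ := h2 π' fun w hw => hπ' w (by simp [hw])
      exact ⟨by simpa using cons h3 hx h4, by grind⟩

end Switching

/-! ### Linkages of constant label -/

/-- There are disjoint paths from `x₁` to `x₂` and from `y₁` to `y₂`, of total label `g`. -/
def Linkage {V : Type*} (L : V → V → ZMod 2 → Prop) (x₁ y₁ x₂ y₂ : V) (g : ZMod 2) : Prop :=
  ∃ D₁ D₂ g₁ g₂, IsLPath L D₁ x₁ x₂ g₁ ∧ IsLPath L D₂ y₁ y₂ g₂ ∧ (∀ x ∈ D₁, x ∉ D₂) ∧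
    g = g₁ + g₂

/-- All pairs of disjoint paths between `{x₁, y₁}` and `{x₂, y₂}` have label `c`. -/
def LinkConst {V : Type*} (L : V → V → ZMod 2 → Prop) (x₁ y₁ x₂ y₂ : V) (c : ZMod 2) : Prop :=
  (∀ g, Linkage L x₁ y₁ x₂ y₂ g → g = c) ∧ ∀ g, Linkage L x₁ y₁ y₂ x₂ g → g = c

/-- `M` is a triconnected labelled graph, and `L` is obtained from it by removing all links between
`x₁` and `y₁` and all links between `x₂` and `y₂`. -/
structure TwoEdges {V : Type*} (M L : V → V → ZMod 2 → Prop) (x₁ y₁ x₂ y₂ : V) : Prop where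
  symm : LSymm M
  irr : ∀ u g, ¬ M u u g
  iff : ∀ u v g, L u v g ↔ M u v g ∧ ¬ (u = x₁ ∧ v = y₁) ∧ ¬ (u = y₁ ∧ v = x₁) ∧
    ¬ (u = x₂ ∧ v = y₂) ∧ ¬ (u = y₂ ∧ v = x₂)
  conn : ∀ a b u v, u ≠ a → u ≠ b → v ≠ a → v ≠ b → ∃ D g, IsLPath M D u v g ∧ a ∉ D ∧ b ∉ D
  ne : x₁ ≠ y₁ ∧ x₂ ≠ y₂ ∧ x₁ ≠ x₂ ∧ x₁ ≠ y₂ ∧ y₁ ≠ x₂ ∧ y₁ ≠ y₂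

section LinkConst

variable {V : Type*} {M L : V → V → ZMod 2 → Prop} {x₁ y₁ x₂ y₂ : V} {c : ZMod 2}

theorem Linkage.swap {g : ZMod 2} (h : Linkage L x₁ y₁ x₂ y₂ g) : Linkage L y₁ x₁ y₂ x₂ g := by
  obtain ⟨D₁, D₂, g₁, g₂, h1, h2, h3, h4⟩ := h
  exact ⟨D₂, D₁, g₂, g₁, h2, h1, by grind, by grind⟩

theorem Linkage.reverse {g : ZMod 2} (hL : LSymm L) (h : Linkage L x₁ y₁ x₂ y₂ g) :
    Linkage L x₂ y₂ x₁ y₁ g := by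
  obtain ⟨D₁, D₂, g₁, g₂, h1, h2, h3, h4⟩ := h
  exact ⟨D₁, D₂, g₁, g₂, h1.symm hL, h2.symm hL, h3, h4⟩

theorem LinkConst.swap (h : LinkConst L x₁ y₁ x₂ y₂ c) : LinkConst L y₁ x₁ y₂ x₂ c :=
  ⟨fun g hg => h.1 g hg.swap, fun g hg => h.2 g hg.swap⟩

theorem LinkConst.swap_right (h : LinkConst L x₁ y₁ x₂ y₂ c) : LinkConst L x₁ y₁ y₂ x₂ c :=
  ⟨h.2, h.1⟩

theorem LinkConst.reverse (hL : LSymm L) (h : LinkConst L x₁ y₁ x₂ y₂ c) :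
    LinkConst L x₂ y₂ x₁ y₁ c :=
  ⟨fun g hg => h.1 g (hg.reverse hL), fun g hg => h.2 g (hg.reverse hL).swap⟩

theorem Linkage.of_switched {π : V → ZMod 2} {g : ZMod 2}
    (h : Linkage (switched L π) x₁ y₁ x₂ y₂ g) :
    Linkage L x₁ y₁ x₂ y₂ (g + (π x₁ + π y₁ + π x₂ + π y₂)) := by
  obtain ⟨D₁, D₂, g₁, g₂, h1, h2, h3, h4⟩ := h
  exact ⟨D₁, D₂, _, _, h1.of_switched, h2.of_switched, h3, by grind⟩

theorem LinkConst.switched (h : LinkConst L x₁ y₁ x₂ y₂ c) (π : V → ZMod 2) :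
    LinkConst (switched L π) x₁ y₁ x₂ y₂ (c + (π x₁ + π y₁ + π x₂ + π y₂)) := by
  refine ⟨fun g hg => ?_, fun g hg => ?_⟩
  · have := h.1 _ hg.of_switched
    grind
  · have := h.2 _ hg.of_switched
    grind

namespace TwoEdges

theorem swap (h : TwoEdges M L x₁ y₁ x₂ y₂) : TwoEdges M L y₁ x₁ y₂ x₂ :=
  ⟨h.symm, h.irr, fun u v g => by rw [h.iff]; tauto, h.conn, by have := h.ne; grind⟩

theorem swap_right (h : TwoEdges M L x₁ y₁ x₂ y₂) : TwoEdges M L x₁ y₁ y₂ x₂ :=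
  ⟨h.symm, h.irr, fun u v g => by rw [h.iff]; tauto, h.conn, by have := h.ne; grind⟩

theorem reverse (h : TwoEdges M L x₁ y₁ x₂ y₂) : TwoEdges M L x₂ y₂ x₁ y₁ :=
  ⟨h.symm, h.irr, fun u v g => by rw [h.iff]; tauto, h.conn, by have := h.ne; grind⟩

theorem switched (h : TwoEdges M L x₁ y₁ x₂ y₂) (π : V → ZMod 2) :
    TwoEdges (switched M π) (switched L π) x₁ y₁ x₂ y₂ :=
  ⟨h.symm.switched π, fun u g => h.irr u _, fun u v g => h.iff u v _, fun a b u v h1 h2 h3 h4 => by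
    obtain ⟨D, g, hD, hab⟩ := h.conn a b u v h1 h2 h3 h4
    exact ⟨D, _, hD.switched π, hab⟩, h.ne⟩

theorem lsymm (h : TwoEdges M L x₁ y₁ x₂ y₂) : LSymm L := by
  intro u v g hl
  rw [h.iff] at hl ⊢
  have := h.symm hl.1
  tauto

/-- Removed links join `x₁` to `y₁` or `x₂` to `y₂`, so a path missing an end of each pair uses
none. -/
theorem lift (h : TwoEdges M L x₁ y₁ x₂ y₂) {D : Set V} {u v : V} {g : ZMod 2}
    (hp : IsLPath M D u v g) (h1 : x₁ ∈ D → y₁ ∉ D) (h2 : x₂ ∈ D → y₂ ∉ D) :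
    IsLPath L D u v g :=
  hp.mono fun u hu v hv g hg => (h.iff _ _ _).2 ⟨hg, by grind, by grind, by grind, by grind⟩

/-- A separator of at most two vertices would miss a vertex of `A` and one of `B`, which
triconnectivity still joins; Menger's theorem applies. -/
theorem hasDisjointPaths [Finite V] (h : TwoEdges M L x₁ y₁ x₂ y₂) {A B : Set V} {k : ℕ}
    (hk : k ≤ 3) (hA : k ≤ A.ncard) (hB : k ≤ B.ncard) : HasDisjointPaths M A B k := by
  refine menger h.symm h.irr fun X hX => ?_
  by_contra! hlt
  obtain ⟨u, hu, huX⟩ : ∃ u ∈ A, u ∉ X := by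
    by_contra! hc
    have := Set.ncard_le_ncard (show A ⊆ X from hc) (Set.toFinite _)
    omega
  obtain ⟨v, hv, hvX⟩ : ∃ u ∈ B, u ∉ X := by
    by_contra! hc
    have := Set.ncard_le_ncard (show B ⊆ X from hc) (Set.toFinite _)
    omega
  -- Smaller sets are padded to fit the two-vertex form of `TwoEdges.conn`.
  have h2 : ∃ a b, u ≠ a ∧ u ≠ b ∧ v ≠ a ∧ v ≠ b ∧ ∀ x ∈ X, x = a ∨ x = b := by
    have h3 : X.ncard = 0 ∨ X.ncard = 1 ∨ X.ncard = 2 := by omega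
    rcases h3 with h3 | h3 | h3
    · obtain ⟨a, hau, hav⟩ : ∃ a, u ≠ a ∧ v ≠ a := by
        by_contra! hc
        have := hc x₁
        have := hc y₁
        have := hc x₂
        have := h.ne
        by_cases u = x₁ <;> by_cases u = y₁ <;> grind
      rw [Set.ncard_eq_zero] at h3
      exact ⟨a, a, by grind⟩
    · obtain ⟨a, rfl⟩ := Set.ncard_eq_one.1 h3
      exact ⟨a, a, by grind⟩
    · obtain ⟨a, b, -, rfl⟩ := Set.ncard_eq_two.1 h3
      exact ⟨a, b, by grind⟩
  obtain ⟨a, b, h3, h4, h5, h6, h7⟩ := h2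
  obtain ⟨D, g, hD, haD, hbD⟩ := h.conn a b u v h3 h4 h5 h6
  obtain ⟨x, hx, hxX⟩ := hX D u v g hD hu hv
  grind

/-- Outer pieces of `C₁` and `C₂` extend `D` and `E` to a linkage, in one pairing or the other, and
contribute nothing to its label. -/
theorem label_add_of_zero (h : TwoEdges M L x₁ y₁ x₂ y₂) (hc : LinkConst L x₁ y₁ x₂ y₂ c)
    {C₁ C₂ : Set V} {e₁ e₂ : ZMod 2} (hC₁ : IsLPath (zeroLinks L) C₁ x₁ y₁ e₁)
    (hC₂ : IsLPath (zeroLinks L) C₂ x₂ y₂ e₂) (hC : ∀ x ∈ C₁, x ∉ C₂)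
    {D E : Set V} {m m' n n' : V} {g k : ZMod 2} (hD : IsLPath L D m m' g)
    (hE : IsLPath L E n n' k) (hm : m ∈ C₁) (hm' : m' ∈ C₂) (hn : n ∈ C₁) (hn' : n' ∈ C₂)
    (hD₁ : ∀ x ∈ D, x ∈ C₁ → x = m) (hD₂ : ∀ x ∈ D, x ∈ C₂ → x = m')
    (hE₁ : ∀ x ∈ E, x ∈ C₁ → x = n) (hE₂ : ∀ x ∈ E, x ∈ C₂ → x = n')
    (hDE : ∀ x ∈ D, x ∉ E) : g + k = c := by
  have key : ∀ {D E : Set V} {m m' n n' : V} {g k : ZMod 2}, IsLPath L D m m' g →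
      IsLPath L E n n' k → m' ∈ C₂ → n' ∈ C₂ →
      (∀ x ∈ D, x ∈ C₁ → x = m) → (∀ x ∈ D, x ∈ C₂ → x = m') →
      (∀ x ∈ E, x ∈ C₁ → x = n) → (∀ x ∈ E, x ∈ C₂ → x = n') →
      (∀ x ∈ D, x ∉ E) → Split3 (zeroLinks L) C₁ x₁ m n y₁ e₁ → g + k = c := by
    clear * - h hc hC₂ hC
    intro D E m m' n n' g k hD hE hm' hn' hD₁ hD₂ hE₁ hE₂ hDE hs
    obtain ⟨A₁, A₂, A₃, a₁, a₂, a₃, h1, h2, h3, h4, h5, h6, h7, -⟩ := hs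
    have hmn : m' ≠ n' := by
      rintro rfl
      exact hDE _ hD.end_mem hE.end_mem
    have h1' := zeroLinks_path h1
    have h3' := (zeroLinks_path h3).symm h.lsymm
    have j1 := h1'.trans hD (by grind)
    have j2 := h3'.trans hE (by grind)
    rcases hC₂.split3 hm' hn' hmn with ⟨B₁, B₂, B₃, b₁, b₂, b₃, k1, k2, k3, k4, k5, k6, k7, -⟩ |
      ⟨B₁, B₂, B₃, b₁, b₂, b₃, k1, k2, k3, k4, k5, k6, k7, -⟩
    · have l1 := j1.trans ((zeroLinks_path k1).symm h.lsymm) (by grind)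
      have l2 := j2.trans (zeroLinks_path k3) (by grind)
      have := hc.1 _ ⟨_, _, _, _, l1, l2, by
        have := k1.end_mem
        have := k3.start_mem
        have := h1.end_mem
        have := h3.start_mem
        grind, rfl⟩
      grind
    · have l1 := j1.trans (zeroLinks_path k3) (by grind)
      have l2 := j2.trans ((zeroLinks_path k1).symm h.lsymm) (by grind)
      have := hc.2 _ ⟨_, _, _, _, l1, l2, by
        have := k1.end_mem
        have := k3.start_mem
        have := h1.end_mem
        have := h3.start_mem
        grind, rfl⟩
      grind
  have hmn : m ≠ n := by
    rintro rfl
    exact hDE _ hD.start_mem hE.start_mem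
  rcases hC₁.split3 hm hn hmn with hs | hs
  · exact key hD hE hm' hn' hD₁ hD₂ hE₁ hE₂ hDE hs
  · rw [add_comm]
    exact key hE hD hn' hm' hE₁ hE₂ hD₁ hD₂ (by grind) hs

/-- A path on two vertices would be a removed link. This is what allows three disjoint paths below.
-/
theorem three_le_ncard (h : TwoEdges M L x₁ y₁ x₂ y₂) {C : Set V} {g : ZMod 2}
    (hC : IsLPath L C x₁ y₁ g) : 3 ≤ C.ncard := by
  have h1 := h.ne.1
  by_contra! hlt
  have h2 : ∀ x ∈ C, x = x₁ ∨ x = y₁ := by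
    by_contra! hc
    obtain ⟨x, hx, hx1, hx2⟩ := hc
    have := (Set.two_lt_ncard_iff hC.finite).2
      ⟨x₁, y₁, x, hC.start_mem, hC.end_mem, hx, by grind, by grind, by grind⟩
    omega
  have := (h.iff _ _ _).1 (hC.link_of_forall h1 h2)
  grind

/-- Three disjoint paths from `C₁` to `C₂` have labels any two of which sum to `c`. Adding the three
equations counts every label twice, so `3c = 0`, that is `c = 0`. -/
theorem linkConst_eq_zero [Finite V] (h : TwoEdges M L x₁ y₁ x₂ y₂)
    (hc : LinkConst L x₁ y₁ x₂ y₂ c)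
    {C₁ C₂ : Set V} {e₁ e₂ : ZMod 2} (hC₁ : IsLPath (zeroLinks L) C₁ x₁ y₁ e₁)
    (hC₂ : IsLPath (zeroLinks L) C₂ x₂ y₂ e₂) (hC : ∀ x ∈ C₁, x ∉ C₂) : c = 0 := by
  obtain ⟨D, s, t, g, hD, hdisj⟩ := h.hasDisjointPaths le_rfl
    (h.three_le_ncard (zeroLinks_path hC₁)) (h.reverse.three_le_ncard (zeroLinks_path hC₂))
  choose s' t' D' g' k1 k2 k3 k4 k5 k6 using
    fun i => (hD i).1.shorten h.symm (hD i).2.1 (hD i).2.2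
  have hdisj' : ∀ i j, i ≠ j → ∀ x ∈ D' i, x ∉ D' j := fun i j hij x hx hx' =>
    hdisj i j hij x (k2 i x hx) (k2 j x hx')
  have hl : ∀ i, IsLPath L (D' i) (s' i) (t' i) (g' i) := by
    have := h.ne.1
    have := h.ne.2.1
    have := hC₁.start_mem
    have := hC₁.end_mem
    have := hC₂.start_mem
    have := hC₂.end_mem
    intro i
    have := k5 i
    have := k6 i
    exact h.lift (k1 i) (by grind) (by grind)
  have key : ∀ i j, i ≠ j → g' i + g' j = c := fun i j hij =>
    h.label_add_of_zero hc hC₁ hC₂ hC (hl i) (hl j) (k3 i) (k4 i) (k3 j) (k4 j) (k5 i) (k6 i)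
      (k5 j) (k6 j) (hdisj' i j hij)
  have h1 := key 0 1 (by decide)
  have h2 := key 1 2 (by decide)
  have h3 := key 0 2 (by decide)
  grind

/-- The cycle formed by two rungs and two disjoint paths between them has label zero. -/
theorem quad_label [Finite V] (h : TwoEdges M L x₁ y₁ x₂ y₂) (hc : LinkConst L x₁ y₁ x₂ y₂ c)
    {X₁ R₁ Y₁ X₂ R₂ Y₂ D E : Set V} {p₁ q₁ p₂ q₂ : V} {a₁ r₁ b₁ a₂ r₂ b₂ m n : ZMod 2}
    (hX₁ : IsLPath L X₁ x₁ p₁ a₁) (hR₁ : IsLPath L R₁ p₁ q₁ r₁) (hY₁ : IsLPath L Y₁ q₁ y₁ b₁)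
    (hX₂ : IsLPath L X₂ x₂ p₂ a₂) (hR₂ : IsLPath L R₂ p₂ q₂ r₂) (hY₂ : IsLPath L Y₂ q₂ y₂ b₂)
    (hD : IsLPath L D p₁ p₂ m) (hE : IsLPath L E q₁ q₂ n)
    (h₁ : ∀ x ∈ X₁, x ∈ R₁ → x = p₁) (h₂ : ∀ x ∈ R₁, x ∈ Y₁ → x = q₁) (h₃ : ∀ x ∈ X₁, x ∉ Y₁)
    (h₄ : ∀ x ∈ X₂, x ∈ R₂ → x = p₂) (h₅ : ∀ x ∈ R₂, x ∈ Y₂ → x = q₂) (h₆ : ∀ x ∈ X₂, x ∉ Y₂)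
    (h₇ : ∀ x, x ∈ X₁ ∨ x ∈ R₁ ∨ x ∈ Y₁ → ¬ (x ∈ X₂ ∨ x ∈ R₂ ∨ x ∈ Y₂))
    (hD₁ : ∀ x ∈ D, x ∈ X₁ ∨ x ∈ R₁ ∨ x ∈ Y₁ → x = p₁)
    (hD₂ : ∀ x ∈ D, x ∈ X₂ ∨ x ∈ R₂ ∨ x ∈ Y₂ → x = p₂)
    (hE₁ : ∀ x ∈ E, x ∈ X₁ ∨ x ∈ R₁ ∨ x ∈ Y₁ → x = q₁)
    (hE₂ : ∀ x ∈ E, x ∈ X₂ ∨ x ∈ R₂ ∨ x ∈ Y₂ → x = q₂)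
    -- Both paths, through `X₁`, `R₁`, `Y₁` and through `X₂`, `R₂`, `Y₂`, are switched to zero piece
    -- by piece. Each piece meets the earlier ones at most in its start, where the old value is
    -- kept.
    (hDE : ∀ x ∈ D, x ∉ E) : r₁ + r₂ + m + n = 0 := by
  obtain ⟨π₁, -, z₁⟩ := hX₁.exists_potential 0
  obtain ⟨π₂, e₂, z₂⟩ := hR₁.exists_potential π₁
  obtain ⟨π₃, e₃, z₃⟩ := hY₁.exists_potential π₂
  obtain ⟨π₄, e₄, z₄⟩ := hX₂.exists_potential π₃
  obtain ⟨π₅, e₅, z₅⟩ := hR₂.exists_potential π₄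
  obtain ⟨π, e₆, z₆⟩ := hY₂.exists_potential π₅
  have hp₁ := hX₁.end_mem
  have hp₁' := hR₁.start_mem
  have hq₁ := hR₁.end_mem
  have hq₁' := hY₁.start_mem
  have hp₂ := hX₂.end_mem
  have hp₂' := hR₂.start_mem
  have hq₂ := hR₂.end_mem
  have hq₂' := hY₂.start_mem
  obtain ⟨w₁, v₁⟩ := z₁ π (by grind)
  obtain ⟨w₂, v₂⟩ := z₂ π (by grind)
  obtain ⟨w₃, v₃⟩ := z₃ π (by grind)
  obtain ⟨w₄, v₄⟩ := z₄ π (by grind)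
  obtain ⟨w₅, v₅⟩ := z₅ π (by grind)
  obtain ⟨w₆, v₆⟩ := z₆ π (by grind)
  have hπ := h.switched π
  have hcπ := hc.switched π
  have hC₁ := (w₁.trans w₂ h₁).trans w₃ (by grind)
  have hC₂ := (w₄.trans w₅ h₄).trans w₆ (by grind)
  have hc0 := hπ.linkConst_eq_zero hcπ hC₁ hC₂ (by grind)
  rw [hc0] at hcπ
  have h8 := hπ.label_add_of_zero hcπ hC₁ hC₂ (by grind) (hD.switched π) (hE.switched π)
    (by grind) (by grind) (by grind) (by grind) (by grind) (by grind) (by grind) (by grind) hDE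
  grind

end TwoEdges

end LinkConst

/-! ### Ears, rungs and forks of a zero linkage -/

/-- A reference linkage `P`, `Q` all of whose links have label zero, where all linkages have label
zero. -/
structure ZeroLinkage {V : Type*} (M L : V → V → ZMod 2 → Prop) (x₁ y₁ x₂ y₂ : V) (P Q : Set V) :
    Prop extends TwoEdges M L x₁ y₁ x₂ y₂ where
  hP : IsLPath (zeroLinks L) P x₁ x₂ 0
  hQ : IsLPath (zeroLinks L) Q y₁ y₂ 0
  disj : ∀ x ∈ P, x ∉ Q
  link : LinkConst L x₁ y₁ x₂ y₂ 0

/-- A rung: a path from `p ∈ P` to `q ∈ Q` with no other vertex in `P` or `Q`. -/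
structure IsRung {V : Type*} (L : V → V → ZMod 2 → Prop) (P Q D : Set V) (p q : V) (g : ZMod 2) :
    Prop where
  path : IsLPath L D p q g
  hp : p ∈ P
  hq : q ∈ Q
  memP : ∀ x ∈ D, x ∈ P → x = p
  memQ : ∀ x ∈ D, x ∈ Q → x = q

/-- A fork: two rungs with different labels that have exactly the vertex `p ∈ P` in common. -/
structure IsFork {V : Type*} (L : V → V → ZMod 2 → Prop) (P Q D₁ D₂ : Set V) (p q₁ q₂ : V)
    (g₁ g₂ : ZMod 2) : Prop where
  left : IsRung L P Q D₁ p q₁ g₁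
  right : IsRung L P Q D₂ p q₂ g₂
  inter : ∀ x ∈ D₁, x ∈ D₂ → x = p
  ne : g₁ ≠ g₂

section

variable {V : Type*} {M L : V → V → ZMod 2 → Prop} {x₁ y₁ x₂ y₂ : V} {P Q D D₁ D₂ : Set V}
  {p q p₁ p₂ q₁ q₂ a b r : V} {g g₁ g₂ : ZMod 2}

theorem IsRung.swap (hL : LSymm L) (h : IsRung L P Q D p q g) : IsRung L Q P D q p g :=
  ⟨h.path.symm hL, h.hq, h.hp, h.memQ, h.memP⟩

theorem IsFork.symm (h : IsFork L P Q D₁ D₂ p q₁ q₂ g₁ g₂) : IsFork L P Q D₂ D₁ p q₂ q₁ g₂ g₁ :=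
  ⟨h.right, h.left, fun x hx hx' => h.inter x hx' hx, h.ne.symm⟩

namespace ZeroLinkage

theorem swap (h : ZeroLinkage M L x₁ y₁ x₂ y₂ P Q) : ZeroLinkage M L y₁ x₁ y₂ x₂ Q P :=
  ⟨h.toTwoEdges.swap, h.hQ, h.hP, fun x hx hx' => h.disj x hx' hx, h.link.swap⟩

theorem reverse (h : ZeroLinkage M L x₁ y₁ x₂ y₂ P Q) : ZeroLinkage M L x₂ y₂ x₁ y₁ P Q :=
  ⟨h.toTwoEdges.reverse, h.hP.symm h.lsymm.zeroLinks, h.hQ.symm h.lsymm.zeroLinks, h.disj,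
    h.link.reverse h.lsymm⟩

/-- Rerouting `Q` through the ear gives a path that forms a linkage with `P'`. Allowing `P'` other
than `P` is needed in `fork_jump`. -/
theorem ear_add {P' : Set V} {g' : ZMod 2} (h : ZeroLinkage M L x₁ y₁ x₂ y₂ P Q)
    (hP' : IsLPath L P' x₁ x₂ g') (hPQ : ∀ x ∈ P', x ∉ Q) (hD : IsLPath L D a b g)
    (hab : a ≠ b) (ha : a ∈ Q) (hb : b ∈ Q) (hDQ : ∀ x ∈ D, x ∈ Q → x = a ∨ x = b)
    (hDP : ∀ x ∈ D, x ∉ P') : g + g' = 0 := by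
  have key : ∀ a b, IsLPath L D a b g → (∀ x ∈ D, x ∈ Q → x = a ∨ x = b) →
      Split3 (zeroLinks L) Q y₁ a b y₂ 0 → g + g' = 0 := by
    intro a b hD hDQ ⟨Q₁, Q₂, Q₃, _, _, _, h1, h2, h3, h4, h5, h6, h7, _⟩
    have k1 := (zeroLinks_path h1).trans hD (by
      have := h1.end_mem
      have := h3.start_mem
      grind)
    have k2 := k1.trans (zeroLinks_path h3) (by
      have := h1.end_mem
      have := h3.start_mem
      grind)
    have := h.link.1 _ ⟨_, _, _, _, hP', k2, by grind, rfl⟩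
    grind
  rcases h.hQ.split3 ha hb hab with hs | hs
  · exact key a b hD hDQ hs
  · exact key b a (hD.symm h.lsymm) (by grind) hs

theorem earQ (h : ZeroLinkage M L x₁ y₁ x₂ y₂ P Q) (hD : IsLPath L D a b g)
    (hab : a ≠ b) (ha : a ∈ Q) (hb : b ∈ Q) (hDQ : ∀ x ∈ D, x ∈ Q → x = a ∨ x = b)
    (hDP : ∀ x ∈ D, x ∉ P) : g = 0 := by
  have := h.ear_add (zeroLinks_path h.hP) h.disj hD hab ha hb hDQ hDP
  grind

theorem earP (h : ZeroLinkage M L x₁ y₁ x₂ y₂ P Q) (hD : IsLPath L D a b g)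
    (hab : a ≠ b) (ha : a ∈ P) (hb : b ∈ P) (hDP : ∀ x ∈ D, x ∈ P → x = a ∨ x = b)
    (hDQ : ∀ x ∈ D, x ∉ Q) : g = 0 :=
  h.swap.earQ hD hab ha hb hDP hDQ

/-- Disjoint rungs have the same label. -/
theorem rung_label_eq [Finite V] (h : ZeroLinkage M L x₁ y₁ x₂ y₂ P Q)
    (hD₁ : IsRung L P Q D₁ p₁ q₁ g₁) (hD₂ : IsRung L P Q D₂ p₂ q₂ g₂)
    (hdisj : ∀ x ∈ D₁, x ∉ D₂) : g₁ = g₂ := by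
  have key : ∀ {D₁ D₂ : Set V} {p₁ p₂ q₁ q₂ : V} {g₁ g₂ : ZMod 2}, IsRung L P Q D₁ p₁ q₁ g₁ →
      IsRung L P Q D₂ p₂ q₂ g₂ → (∀ x ∈ D₁, x ∉ D₂) →
      Split3 (zeroLinks L) P x₁ p₁ p₂ x₂ 0 → g₁ = g₂ := by
    clear hD₁ hD₂ hdisj
    intro D₁ D₂ p₁ p₂ q₁ q₂ g₁ g₂ hD₁ hD₂ hdisj
      ⟨P₁, P₂, P₃, _, _, _, h1, h2, h3, h4, h5, h6, h7, _⟩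
    have hPQ := h.disj
    obtain ⟨d1, d2, d3, d4, d5⟩ := hD₁
    obtain ⟨e1, e2, e3, e4, e5⟩ := hD₂
    have i1 := d1.start_mem
    have i2 := d1.end_mem
    have i3 := e1.start_mem
    have i4 := e1.end_mem
    have i5 := h1.end_mem
    have i6 := h3.start_mem
    rcases h.hQ.split3 d3 e3 (by rintro rfl; exact hdisj _ i2 i4) with
      ⟨Q₁, Q₂, Q₃, _, _, _, k1, k2, k3, k4, k5, k6, k7, _⟩ |
      ⟨Q₁, Q₂, Q₃, _, _, _, k1, k2, k3, k4, k5, k6, k7, _⟩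
    · have := k1.end_mem
      have := k3.start_mem
      -- Rungs in the same order on `P` and `Q`: they form a zero cycle with the segments between
      -- them.
      have := h.quad_label h.link (zeroLinks_path h1) d1 ((zeroLinks_path k1).symm h.lsymm)
        ((zeroLinks_path h3).symm h.lsymm) e1 (zeroLinks_path k3) (zeroLinks_path h2)
        (zeroLinks_path k2) (by grind) (by grind) (by grind) (by grind) (by grind) (by grind)
        (by grind) (by grind) (by grind) (by grind) (by grind) (by grind)
      grind
    · have := k1.end_mem
      have := k3.start_mem
      -- Rungs in opposite order: switching sides along both gives a linkage of the other pairing.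
      have l1 := ((zeroLinks_path h1).trans d1 (by grind)).trans (zeroLinks_path k3) (by grind)
      have l2 := ((zeroLinks_path k1).trans (e1.symm h.lsymm) (by grind)).trans
        (zeroLinks_path h3) (by grind)
      have := h.link.2 _ ⟨_, _, _, _, l1, l2, by grind, rfl⟩
      grind
  rcases h.hP.split3 hD₁.hp hD₂.hp (by
    rintro rfl; exact hdisj _ hD₁.path.start_mem hD₂.path.start_mem) with hs | hs
  · exact key hD₁ hD₂ hdisj hs
  · exact (key hD₂ hD₁ (by grind) hs).symm

/-- Rungs of a fork can only be left towards `P` through their common end. -/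
theorem fork_attach [Finite V] (h : ZeroLinkage M L x₁ y₁ x₂ y₂ P Q)
    (hf : IsFork L P Q D₁ D₂ p q₁ q₂ g₁ g₂) (hD : IsLPath L D r a g)
    (hr : r ∈ D₁ ∨ r ∈ D₂) (ha : a ∈ P) (hap : a ≠ p) (hDP : ∀ x ∈ D, x ∈ P → x = a)
    (hDQ : ∀ x ∈ D, x ∉ Q) : False := by
  have key : ∀ {D₁ D₂ D : Set V} {q₁ q₂ z : V} {g₁ g₂ g : ZMod 2},
      IsFork L P Q D₁ D₂ p q₁ q₂ g₁ g₂ → IsLPath L D a z g → z ∈ D₁ →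
      (∀ x ∈ D, x ∈ P → x = a) → (∀ x ∈ D, x ∉ Q) →
      (∀ x ∈ D, x ∈ D₁ ∨ x ∈ D₂ → x = z) → False := by
    clear hf hr hDP hDQ hD
    intro D₁ D₂ D q₁ q₂ z g₁ g₂ g ⟨⟨h1, h2, h3, h4, h5⟩, hr₂, hi, hne⟩ hD hz hDP hDQ hDz
    obtain ⟨k1, k2, k3, k4, k5⟩ := hr₂
    obtain ⟨A₁, A₂, a₁, a₂, l1, l2, l3, l4, l5⟩ := h1.split hz
    have i1 := h1.start_mem
    have i2 := h1.end_mem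
    have i3 := k1.start_mem
    have i4 := l2.end_mem
    have i5 := hD.start_mem
    have i6 := hD.end_mem
    have i7 := l1.start_mem
    have hPQ := h.disj
    -- The way from `p` along the fork to `z` and on to `a` is a zero ear. Starting at `a` instead
    -- of `p` thus preserves the label of the first rung but makes it disjoint from the second.
    have e1 := h.earP (l1.trans (hD.symm h.lsymm) (by grind)) (Ne.symm hap) h2 ha (by grind)
      (by grind)
    have e2 : IsRung L P Q (D ∪ A₂) a q₁ (g + a₂) :=
      ⟨hD.trans l2 (by grind), ha, h3, by grind, by grind⟩
    have e3 := h.rung_label_eq e2 ⟨k1, k2, k3, k4, k5⟩ (by grind)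
    grind
  obtain ⟨z, T, T', t, t', h1, -, h3, -, -, h6, h7⟩ := (hD.symm h.lsymm).first_hit
    (X := D₁ ∪ D₂) hD.start_mem hr
  rcases h6 with h6 | h6
  · exact key hf h1 h6 (by grind) (by grind) (by grind)
  · exact key hf.symm h1 h6 (by grind) (by grind) (by grind)

/-- A rung avoiding both prongs would have both of their labels. Meeting them anywhere but in its
end on `Q` is excluded by `fork_attach`. -/
theorem fork_rung [Finite V] (h : ZeroLinkage M L x₁ y₁ x₂ y₂ P Q)
    (hf : IsFork L P Q D₁ D₂ p q₁ q₂ g₁ g₂) (hD : IsRung L P Q D a b g) (hap : a ≠ p) :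
    (∀ x ∈ D, x ∈ D₁ ∨ x ∈ D₂ → x = b ∧ (b = q₁ ∨ b = q₂)) ∧ (b = q₁ ∨ b = q₂) := by
  have h1 : ∀ x ∈ D, x ∈ D₁ ∨ x ∈ D₂ → x = b ∧ (b = q₁ ∨ b = q₂) := by
    intro x hx hx'
    by_cases hxb : x = b
    · subst hxb
      have := hf.left.memQ x
      have := hf.right.memQ x
      have := hD.hq
      grind
    · exfalso
      obtain ⟨A₁, A₂, a₁, a₂, l1, l2, l3, l4, l5⟩ := hD.path.split hx
      obtain ⟨d1, d2, d3, d4, d5⟩ := hD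
      have := l2.end_mem
      exact h.fork_attach hf (l1.symm h.lsymm) hx' d2 hap (by grind) (by grind)
  refine ⟨h1, ?_⟩
  by_contra! hb
  have e1 := h.rung_label_eq hD hf.left (by grind)
  have e2 := h.rung_label_eq hD hf.right (by grind)
  exact hf.ne (e1.symm.trans e2)

/-- No ear on `P` jumps over the end of a fork. -/
theorem fork_jump [Finite V] (h : ZeroLinkage M L x₁ y₁ x₂ y₂ P Q)
    (hf : IsFork L P Q D₁ D₂ p q₁ q₂ g₁ g₂) {A B : Set V} {c d : ZMod 2}
    (hA : IsLPath (zeroLinks L) A x₁ p c) (hB : IsLPath (zeroLinks L) B p x₂ d)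
    (hAB : ∀ x ∈ A, x ∈ B → x = p) (hP : ∀ x, x ∈ P ↔ x ∈ A ∨ x ∈ B)
    (hD : IsLPath L D a b g) (ha : a ∈ A) (hap : a ≠ p) (hb : b ∈ B) (hbp : b ≠ p)
    (hDP : ∀ x ∈ D, x ∈ P → x = a ∨ x = b) (hDQ : ∀ x ∈ D, x ∉ Q) : False := by
  have hDD : ∀ x ∈ D, ¬ (x ∈ D₁ ∨ x ∈ D₂) := by
    intro x hx hx'
    obtain ⟨E₁, E₂, e₁, e₂, l1, l2, l3, l4, l5⟩ := hD.split hx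
    have i1 := hf.left.memP
    have i2 := hf.right.memP
    have i3 := l1.start_mem
    have i4 := l2.end_mem
    exact h.fork_attach hf l2 hx' ((hP b).2 (.inr hb)) hbp (by grind) (by grind)
  obtain ⟨A₁, A₂, a₁, a₂, l1, l2, l3, l4, l5⟩ := hA.split ha
  obtain ⟨B₁, B₂, b₁, b₂, m1, m2, m3, m4, m5⟩ := hB.split hb
  have i1 := l2.end_mem
  have i2 := m1.start_mem
  have i3 := l1.end_mem
  have i4 := m2.start_mem
  have hPQ := h.disj
  -- Rerouting `P` through the ear frees `p`, so the two prongs become an ear on `Q` with label `g₁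
  -- + g₂ ≠ 0`.
  have n1 := ((zeroLinks_path l1).trans hD (by grind)).trans (zeroLinks_path m2) (by grind)
  have e0 := h.earP hD (by grind) (by grind) (by grind) hDP hDQ
  obtain ⟨⟨h1, h2, h3, h4, h5⟩, ⟨k1, k2, k3, k4, k5⟩, hi, hne⟩ := hf
  have i5 := h1.end_mem
  have i6 := k1.end_mem
  have n2 := (h1.symm h.lsymm).trans k1 hi
  have := h.ear_add n1 (by grind) n2 (by grind) h3 k3 (by grind) (by grind)
  apply hne
  grind

end ZeroLinkage

end

/-! ### Excluding forks -/

namespace ZeroLinkage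

variable {V : Type*} {M L : V → V → ZMod 2 → Prop} {x₁ y₁ x₂ y₂ : V} {P Q D D₁ D₂ J : Set V}
  {p q k p₁ p₂ q₁ q₂ a b r : V} {g g₁ g₂ e : ZMod 2}

/-- The common rung of two forks, one on each side, has no inner vertex. -/
theorem fork_inner [Finite V] (h : ZeroLinkage M L x₁ y₁ x₂ y₂ P Q)
    (hf : IsFork L P Q D₁ D₂ p q₁ q₂ g₁ g₂) (hf' : IsFork L Q P D₁ J q₁ p k g₁ e) (hr : r ∈ D₁) :
    r = p ∨ r = q₁ := by
  by_contra! hc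
  have hPQ := h.disj
  have hkp : k ≠ p := by
    rintro rfl
    have := hf'.inter k hf.left.path.start_mem hf'.right.path.end_mem
    have := hf.left.hp
    have := hf.left.hq
    grind
  have hk := hf'.right.hq
  have hq := hf.left.hq
  -- The first vertex on `P ∪ Q` of a path from `r` avoiding `p` and `q₁` is a forbidden attachment
  -- for one of the two forks.
  obtain ⟨E, c, hE, hpE, hqE⟩ := h.conn p q₁ r k hc.1 hc.2 hkp (by grind)
  obtain ⟨z, T, T', t, t', h1, -, h3, -, -, h6, h7⟩ := hE.first_hit (X := P ∪ Q) hE.end_mem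
    (.inl hk)
  have hx₁ := h.hP.start_mem
  have hx₂ := h.hP.end_mem
  have hy₁ := h.hQ.start_mem
  have hy₂ := h.hQ.end_mem
  have hne := h.ne
  have hT := h.lift h1 (by grind) (by grind)
  have hz := h1.end_mem
  rcases h6 with h6 | h6
  · exact h.fork_attach hf hT (.inl hr) h6 (by grind) (by grind) (by grind)
  · exact h.swap.fork_attach hf' hT (.inl hr) h6 (by grind) (by grind) (by grind)

/-- After removal of `p` and `q₁`, some path still leads from the initial sides of `P` and `Q` to
the final sides. It cannot be an ear, by `fork_jump`, so it is a rung, and the two forks pin its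
ends to `k` and `q₂`. The rung `D₁` is a single link, hence disjoint from it. -/
theorem fork_cross [Finite V] (h : ZeroLinkage M L x₁ y₁ x₂ y₂ P Q)
    (hf : IsFork L P Q D₁ D₂ p q₁ q₂ g₁ g₂) (hf' : IsFork L Q P D₁ J q₁ p k g₁ e)
    {A B A' B' : Set V} {c d c' d' : ZMod 2}
    (hA : IsLPath (zeroLinks L) A x₁ p c) (hB : IsLPath (zeroLinks L) B p x₂ d)
    (hAB : ∀ x ∈ A, x ∈ B → x = p) (hP : ∀ x, x ∈ P ↔ x ∈ A ∨ x ∈ B)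
    (hA' : IsLPath (zeroLinks L) A' y₁ q₁ c') (hB' : IsLPath (zeroLinks L) B' q₁ y₂ d')
    (hAB' : ∀ x ∈ A', x ∈ B' → x = q₁) (hQ : ∀ x, x ∈ Q ↔ x ∈ A' ∨ x ∈ B') :
    ∃ E, IsRung L P Q E k q₂ g₁ ∧ (∀ x ∈ E, x ∈ J → x = k) ∧
      (k ∈ A ∧ q₂ ∈ B' ∨ k ∈ B ∧ q₂ ∈ A') := by
  have hPQ := h.disj
  have hD₁ := fun r => h.fork_inner hf hf' (r := r)
  have hx₁ := hA.start_mem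
  have hx₂ := hB.end_mem
  have hy₁ := hA'.start_mem
  have hy₂ := hB'.end_mem
  have hne := h.ne
  have hp := hf.left.hp
  have hq := hf.left.hq
  -- As a link of `L`, the pair `p`, `q₁` is neither `x₁`, `y₁` nor `x₂`, `y₂`, so a vertex remains
  -- on each side.
  have hlink := (h.iff _ _ _).1 (hf.left.path.link_of_forall (by grind) hD₁)
  obtain ⟨u, hu, hup, huq⟩ : ∃ u, (u ∈ A ∨ u ∈ A') ∧ u ≠ p ∧ u ≠ q₁ := by
    by_cases hxp : x₁ = p
    · exact ⟨y₁, by grind⟩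
    · exact ⟨x₁, by grind⟩
  obtain ⟨v, hv, hvp, hvq⟩ : ∃ v, (v ∈ B ∨ v ∈ B') ∧ v ≠ p ∧ v ≠ q₁ := by
    by_cases hxp : x₂ = p
    · exact ⟨y₂, by grind⟩
    · exact ⟨x₂, by grind⟩
  obtain ⟨E, b, hE, hpE, hqE⟩ := h.conn p q₁ u v hup huq hvp hvq
  obtain ⟨s, t, T, f, h1, h2, h3, h4, h5, h6⟩ := hE.shorten h.symm
    (X := A ∪ A') (Y := B ∪ B') hu hv
  have hT := h.lift h1 (by grind) (by grind)
  have hs := hT.start_mem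
  have ht := hT.end_mem
  have main : ∀ {s t : V} {T : Set V}, IsRung L P Q T s t f → s ≠ p → t ≠ q₁ →
      t = q₂ ∧ s = k ∧ f = g₁ ∧ ∀ x ∈ T, x ∈ J → x = k := by
    intro s t T hT hsp htq
    obtain ⟨e1, e2⟩ := h.fork_rung hf hT hsp
    obtain ⟨e3, e4⟩ := h.swap.fork_rung hf' (hT.swap h.lsymm) htq
    have := hT.path.start_mem
    have := hT.path.end_mem
    have := hT.memP
    have := hT.memQ
    refine ⟨by grind, by grind, ?_, by grind⟩
    apply h.rung_label_eq hT hf.left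
    grind
  rcases h3 with h3 | h3 <;> rcases h4 with h4 | h4
  · exact (h.fork_jump hf hA hB hAB hP hT h3 (by grind) h4 (by grind) (by grind)
      (by grind)).elim
  · have hR : IsRung L P Q T s t f := ⟨hT, by grind, by grind, by grind, by grind⟩
    obtain ⟨rfl, rfl, rfl, e4⟩ := main hR (by grind) (by grind)
    exact ⟨T, hR, e4, .inl ⟨h3, h4⟩⟩
  · have hR : IsRung L P Q T t s f := ⟨hT.symm h.lsymm, by grind, by grind, by grind, by grind⟩
    obtain ⟨rfl, rfl, rfl, e4⟩ := main hR (by grind) (by grind)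
    exact ⟨T, hR, e4, .inr ⟨h4, h3⟩⟩
  · exact (h.swap.fork_jump hf' hA' hB' hAB' hQ hT h3 (by grind) h4 (by grind) (by grind)
      (by grind)).elim

/-- The rungs `D₁`, `D` and the one from `fork_cross` form a configuration in which `p` and `k` can
exchange roles. Applying `fork_cross` again reverses the order of `p` and `k` on `P` but leaves `q₁`
and `q₂` in place, a contradiction. -/
theorem no_fork_of_rung [Finite V] (h : ZeroLinkage M L x₁ y₁ x₂ y₂ P Q)
    (hf : IsFork L P Q D₁ D₂ p q₁ q₂ g₁ g₂) (hD : IsRung L P Q D k q₁ g) (hkp : k ≠ p) :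
    False := by
  have hPQ := h.disj
  have hq : q₁ ≠ q₂ := by
    rintro rfl
    have := hf.inter _ hf.left.path.end_mem hf.right.path.end_mem
    have := hf.left.hq
    have := hf.left.hp
    grind
  obtain ⟨e1, -⟩ := h.fork_rung hf hD hkp
  have hg : g = g₂ := by
    apply h.rung_label_eq hD hf.right
    have := hf.right.memQ
    have := hf.left.hq
    grind
  have hne := hf.ne
  have hf' : IsFork L Q P D₁ D q₁ p k g₁ g :=
    ⟨hf.left.swap h.lsymm, hD.swap h.lsymm, by grind, by grind⟩
  obtain ⟨A, B, a, b, hA, hB, hP, hAB, -⟩ := h.hP.split hf.left.hp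
  obtain ⟨A', B', a', b', hA', hB', hQ, hAB', -⟩ := h.hQ.split hf.left.hq
  obtain ⟨E, hE, hEJ, hpos⟩ := h.fork_cross hf hf' hA hB hAB hP hA' hB' hAB' hQ
  have hf₂ : IsFork L P Q D E k q₁ q₂ g g₁ := ⟨hD, hE, by grind, by grind⟩
  have hf₂' : IsFork L Q P D D₁ q₁ k p g g₁ :=
    ⟨hD.swap h.lsymm, hf.left.swap h.lsymm, by grind, by grind⟩
  have hpA := hA.end_mem
  have hpB := hB.start_mem
  rcases hpos with ⟨hk, hq₂⟩ | ⟨hk, hq₂⟩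
  · obtain ⟨A₁, A₂, a₁, a₂, l1, l2, l3, l4, -⟩ := hA.split hk
    have := l2.end_mem
    obtain ⟨-, -, -, hpos⟩ := h.fork_cross hf₂ hf₂' l1 (l2.trans hB (by grind)) (by grind)
      (by grind) hA' hB' hAB' hQ
    grind
  · obtain ⟨B₁, B₂, b₁, b₂, l1, l2, l3, l4, -⟩ := hB.split hk
    have := l1.start_mem
    obtain ⟨-, -, -, hpos⟩ := h.fork_cross hf₂ hf₂' (hA.trans l1 (by grind)) l2 (by grind)
      (by grind) hA' hB' hAB' hQ
    grind

/-- A path leaving the segment from `x₁` to `p` without using `p` either jumps over `p` or is a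
rung, which must end at `q₁` or `q₂`. -/
theorem no_fork_of_ne [Finite V] (h : ZeroLinkage M L x₁ y₁ x₂ y₂ P Q)
    (hf : IsFork L P Q D₁ D₂ p q₁ q₂ g₁ g₂) (hx : x₁ ≠ p) : False := by
  have hPQ := h.disj
  have hq : q₁ ≠ q₂ := by
    rintro rfl
    have := hf.inter _ hf.left.path.end_mem hf.right.path.end_mem
    have := hf.left.hq
    have := hf.left.hp
    grind
  obtain ⟨A, B, a, b, hA, hB, hP, hAB, -⟩ := h.hP.split hf.left.hp
  have hp := hf.left.hp
  have hq₁ := hf.left.hq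
  have hq₂ := hf.right.hq
  have hx₁ := hA.start_mem
  have hx₂ := hB.end_mem
  have hy₁ := h.hQ.start_mem
  have hy₂ := h.hQ.end_mem
  have hne := h.ne
  obtain ⟨q, hqQ, hqy⟩ : ∃ q, q ∈ Q ∧ q ≠ y₁ := by
    by_cases h1 : q₁ = y₁
    · exact ⟨q₂, by grind⟩
    · exact ⟨q₁, by grind⟩
  -- Avoiding `y₁` as well ensures that no removed link at `x₁` is used.
  obtain ⟨E, c, hE, hpE, hyE⟩ := h.conn p y₁ x₁ q hx (by grind) (by grind) hqy
  obtain ⟨s, t, T, f, h1, h2, h3, h4, h5, h6⟩ := hE.shorten h.symm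
    (X := A) (Y := B ∪ Q) hx₁ (.inr hqQ)
  have hT := h.lift h1 (by grind) (by grind)
  have hs := hT.start_mem
  have ht := hT.end_mem
  rcases h4 with h4 | h4
  · exact h.fork_jump hf hA hB hAB hP hT h3 (by grind) h4 (by grind) (by grind) (by grind)
  · have hR : IsRung L P Q T s t f := ⟨hT, by grind, by grind, by grind, by grind⟩
    obtain ⟨-, rfl | rfl⟩ := h.fork_rung hf hR (by grind)
    · exact h.no_fork_of_rung hf hR (by grind)
    · exact h.no_fork_of_rung hf.symm hR (by grind)

theorem no_fork [Finite V] (h : ZeroLinkage M L x₁ y₁ x₂ y₂ P Q)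
    (hf : IsFork L P Q D₁ D₂ p q₁ q₂ g₁ g₂) : False := by
  have := h.ne
  by_cases hx : x₁ = p
  · exact h.reverse.no_fork_of_ne hf (by grind)
  · exact h.no_fork_of_ne hf hx

end ZeroLinkage

/-! ### Non-zero cycles against a zero linkage -/

/-- `C` is the vertex set of a closed walk formed by two internally disjoint paths from `u` to `v`
with different labels. -/
def NonzeroCycle {V : Type*} (L : V → V → ZMod 2 → Prop) (C : Set V) (u v : V) : Prop :=
  ∃ C₁ C₂ g₁ g₂, IsLPath L C₁ u v g₁ ∧ IsLPath L C₂ u v g₂ ∧ (∀ x, x ∈ C ↔ x ∈ C₁ ∨ x ∈ C₂) ∧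
    (∀ x ∈ C₁, x ∈ C₂ → x = u ∨ x = v) ∧ u ≠ v ∧ g₁ ≠ g₂

namespace NonzeroCycle

variable {V : Type*} {L : V → V → ZMod 2 → Prop} {C : Set V} {u v a b : V}

theorem symm (hL : LSymm L) (h : NonzeroCycle L C u v) : NonzeroCycle L C v u := by
  obtain ⟨C₁, C₂, g₁, g₂, h1, h2, h3, h4, h5, h6⟩ := h
  exact ⟨C₁, C₂, g₁, g₂, h1.symm hL, h2.symm hL, h3, by grind, h5.symm, h6⟩

/-- Moving a segment from one arc to the other adds its label to both sides of the inequality. -/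
theorem move_start (hL : LSymm L) (h : NonzeroCycle L C u v) (ha : a ∈ C) (hav : a ≠ v) :
    NonzeroCycle L C a v := by
  obtain ⟨C₁, C₂, g₁, g₂, h1, h2, h3, h4, h5, h6⟩ := h
  have key : ∀ {C₁ C₂ : Set V} {g₁ g₂ : ZMod 2}, IsLPath L C₁ u v g₁ → IsLPath L C₂ u v g₂ →
      (∀ x, x ∈ C ↔ x ∈ C₁ ∨ x ∈ C₂) → (∀ x ∈ C₁, x ∈ C₂ → x = u ∨ x = v) → g₁ ≠ g₂ →
      a ∈ C₁ → NonzeroCycle L C a v := by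
    clear * - hL hav h5
    intro C₁ C₂ g₁ g₂ h1 h2 h3 h4 h6 ha
    obtain ⟨A, B, e, f, l1, l2, l3, l4, l5⟩ := h1.split ha
    have := l1.start_mem
    have := l2.end_mem
    exact ⟨B, A ∪ C₂, f, e + g₂, l2, (l1.symm hL).trans h2 (by grind), by grind, by grind, hav,
      by grind⟩
  rcases (h3 a).1 ha with ha | ha
  · exact key h1 h2 h3 h4 h6 ha
  · exact key h2 h1 (by grind) (by grind) h6.symm ha

theorem move (hL : LSymm L) (h : NonzeroCycle L C u v) (ha : a ∈ C) (hb : b ∈ C) (hab : a ≠ b) :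
    NonzeroCycle L C a b := by
  by_cases hav : a = v
  · subst hav
    exact (h.move_start hL hb (Ne.symm hab)).symm hL
  · exact (((h.move_start hL ha hav).symm hL).move_start hL hb (Ne.symm hab)).symm hL

end NonzeroCycle

/-- A path between vertices of `K` whose label differs from the potential difference contains such
a path with no inner vertex in `K`. -/
theorem IsLPath.exists_ear {V : Type*} {L : V → V → ZMod 2 → Prop} {E K : Set V} {s t : V}
    {g : ZMod 2} (π : V → ZMod 2) (hE : IsLPath L E s t g) (hs : s ∈ K) (ht : t ∈ K)
    (hg : g ≠ π s + π t) :
    ∃ s' t' E₁ R E₂ e₁ r e₂, IsLPath L E₁ s s' e₁ ∧ IsLPath L R s' t' r ∧ IsLPath L E₂ t' t e₂ ∧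
      (∀ x, x ∈ E ↔ x ∈ E₁ ∨ x ∈ R ∨ x ∈ E₂) ∧ (∀ x ∈ E₁, x ∈ R → x = s') ∧
      (∀ x ∈ R, x ∈ E₂ → x = t') ∧ (∀ x ∈ E₁, x ∉ E₂) ∧ g = e₁ + r + e₂ ∧ s' ∈ K ∧ t' ∈ K ∧
      (∀ x ∈ R, x ∈ K → x = s' ∨ x = t') ∧ s' ≠ t' ∧ r ≠ π s' + π t' := by
  induction hn : E.ncard using Nat.strong_induction_on generalizing E s t g with
  | _ n ih =>
  subst hn
  have hst : s ≠ t := by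
    rintro rfl
    obtain ⟨-, rfl⟩ := hE.eq_nil
    grind
  by_cases hz : ∃ z ∈ E, z ∈ K ∧ z ≠ s ∧ z ≠ t
  · obtain ⟨z, hzE, hzK, hzs, hzt⟩ := hz
    obtain ⟨A, B, a, b, h1, h2, h3, h4, h5⟩ := hE.split hzE
    have i1 := h1.start_mem
    have i2 := h2.end_mem
    have i3 := hE.start_mem
    have i4 := hE.end_mem
    by_cases ha : a = π s + π z
    · have hlt : B.ncard < E.ncard := by
        refine Set.ncard_lt_ncard ⟨fun x hx => by grind, fun hsub => ?_⟩ hE.finite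
        have := hsub i3
        grind
      obtain ⟨s', t', E₁, R, E₂, e₁, r, e₂, k1, k2, k3, k4, k5, k6, k7, k8, k9⟩ :=
        ih _ hlt h2 hzK ht (by grind) rfl
      have := k1.start_mem
      have := k2.start_mem
      exact ⟨s', t', A ∪ E₁, R, E₂, a + e₁, r, e₂, h1.trans k1 (by grind), k2, k3, by grind,
        by grind, by grind, by grind, by grind, k9⟩
    · have hlt : A.ncard < E.ncard := by
        refine Set.ncard_lt_ncard ⟨fun x hx => by grind, fun hsub => ?_⟩ hE.finite
        have := hsub i4
        grind
      obtain ⟨s', t', E₁, R, E₂, e₁, r, e₂, k1, k2, k3, k4, k5, k6, k7, k8, k9⟩ :=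
        ih _ hlt h1 hs hzK ha rfl
      have := k3.end_mem
      have := k2.end_mem
      exact ⟨s', t', E₁, R, E₂ ∪ B, e₁, r, e₂ + b, k1, k2, k3.trans h2 (by grind), by grind,
        by grind, by grind, by grind, by grind, k9⟩
  · exact ⟨s, t, {s}, E, {t}, 0, g, 0, .nil s, hE, .nil t, by
      have := hE.start_mem
      have := hE.end_mem
      grind, by grind, by grind, by grind, by grind, hs, ht, by grind, hst, hg⟩

namespace ZeroLinkage

variable {V : Type*} {M L : V → V → ZMod 2 → Prop} {x₁ y₁ x₂ y₂ : V} {P Q C R R' : Set V}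
  {p q u v z : V} {r r' : ZMod 2}

/-- The two arcs of the cycle give two ears on `P` with different labels, yet both must be zero. -/
theorem cycle_ear (h : ZeroLinkage M L x₁ y₁ x₂ y₂ P Q) {c₁ c₂ k₁ k₂ : V} {T₁ T₂ : Set V}
    {t₁ t₂ : ZMod 2} (hC : NonzeroCycle L C c₁ c₂) (h₁ : IsLPath L T₁ c₁ k₁ t₁)
    (h₂ : IsLPath L T₂ c₂ k₂ t₂) (hTC₁ : ∀ x ∈ T₁, x ∈ C → x = c₁)
    (hTC₂ : ∀ x ∈ T₂, x ∈ C → x = c₂) (hTK₁ : ∀ x ∈ T₁, x ∈ P ∨ x ∈ Q → x = k₁)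
    (hTK₂ : ∀ x ∈ T₂, x ∈ P ∨ x ∈ Q → x = k₂) (hT : ∀ x ∈ T₁, x ∉ T₂)
    (hCK : ∀ x ∈ C, x ∈ P ∨ x ∈ Q → x = k₁ ∨ x = k₂) (hk₁ : k₁ ∈ P) (hk₂ : k₂ ∈ P) : False := by
  obtain ⟨C₁, C₂, g₁, g₂, l1, l2, l3, l4, l5, l6⟩ := hC
  have hPQ := h.disj
  have i1 := h₁.end_mem
  have i2 := h₂.end_mem
  have key : ∀ {C₁ : Set V} {g₁ : ZMod 2}, IsLPath L C₁ c₁ c₂ g₁ → (∀ x ∈ C₁, x ∈ C) →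
      t₁ + g₁ + t₂ = 0 := by
    intro C₁ g₁ hC₁ hsub
    have := ((h₁.symm h.lsymm).trans hC₁ (by grind)).trans h₂ (by grind)
    exact h.earP this (by grind) hk₁ hk₂ (by grind) (by grind)
  have e1 := key l1 (by grind)
  have e2 := key l2 (by grind)
  grind

theorem exists_paths [Finite V] (h : ZeroLinkage M L x₁ y₁ x₂ y₂ P Q) (hC : 3 ≤ C.ncard) :
    ∃ (c k : Fin 3 → V) (T : Fin 3 → Set V) (t : Fin 3 → ZMod 2),
      (∀ i, IsLPath L (T i) (c i) (k i) (t i) ∧ c i ∈ C ∧ (k i ∈ P ∨ k i ∈ Q) ∧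
        (∀ x ∈ T i, x ∈ C → x = c i) ∧ ∀ x ∈ T i, x ∈ P ∨ x ∈ Q → x = k i) ∧
      ∀ i j, i ≠ j → ∀ x ∈ T i, x ∉ T j := by
  have hne := h.ne
  have hx₁ := h.hP.start_mem
  have hx₂ := h.hP.end_mem
  have hy₁ := h.hQ.start_mem
  have hy₂ := h.hQ.end_mem
  have hK : 3 ≤ (P ∪ Q).ncard := (Set.two_lt_ncard_iff (Set.toFinite _)).2
    ⟨x₁, x₂, y₁, .inl hx₁, .inl hx₂, .inr hy₁, by grind, by grind, by grind⟩
  obtain ⟨D, s, t, g, hD, hdisj⟩ := h.hasDisjointPaths le_rfl hC hK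
  choose s' t' D' g' k1 k2 k3 k4 k5 k6 using
    fun i => (hD i).1.shorten h.symm (hD i).2.1 (hD i).2.2
  refine ⟨s', t', D', g', fun i => ⟨h.lift (k1 i) ?_ ?_, k3 i, k4 i, k5 i, k6 i⟩,
    fun i j hij x hx hx' => hdisj i j hij x (k2 i x hx) (k2 j x hx')⟩
  · have := k6 i x₁
    have := k6 i y₁
    grind
  · have := k6 i x₂
    have := k6 i y₂
    grind

/-- Of three disjoint paths from the cycle to `P ∪ Q`, two end on the same side. -/
theorem cycle_disjoint [Finite V] (h : ZeroLinkage M L x₁ y₁ x₂ y₂ P Q)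
    (hC : NonzeroCycle L C u v) (hC3 : 3 ≤ C.ncard) (hCK : ∀ x ∈ C, ¬ (x ∈ P ∨ x ∈ Q)) :
    False := by
  obtain ⟨c, k, T, t, hT, hdisj⟩ := h.exists_paths hC3
  obtain ⟨i, j, hij, hk⟩ : ∃ i j, i ≠ j ∧ (k i ∈ P ∧ k j ∈ P ∨ k i ∈ Q ∧ k j ∈ Q) := by
    have h0 := (hT 0).2.2.1
    have h1 := (hT 1).2.2.1
    have h2 := (hT 2).2.2.1
    have n1 : (0 : Fin 3) ≠ 1 := by decide
    have n2 : (0 : Fin 3) ≠ 2 := by decide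
    have n3 : (1 : Fin 3) ≠ 2 := by decide
    grind
  obtain ⟨i1, i2, i3, i4, i5⟩ := hT i
  obtain ⟨j1, j2, j3, j4, j5⟩ := hT j
  have hd := hdisj i j hij
  have hc : c i ≠ c j := fun he => hd _ i1.start_mem (he ▸ j1.start_mem)
  have hm := hC.move h.lsymm i2 j2 hc
  rcases hk with ⟨hi, hj⟩ | ⟨hi, hj⟩
  · exact h.cycle_ear hm i1 j1 i4 j4 i5 j5 hd (by grind) hi hj
  · exact h.swap.cycle_ear hm i1 j1 i4 j4 (by grind) (by grind) hd (by grind) hi hj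

/-- Two of three disjoint connecting paths avoid `z`. Neither can end in `P`, by `cycle_ear` with a
trivial path at `z`, so both reach `Q` and make a fork at `z`. -/
theorem cycle_touch [Finite V] (h : ZeroLinkage M L x₁ y₁ x₂ y₂ P Q)
    (hC : NonzeroCycle L C u v) (hC3 : 3 ≤ C.ncard) (hz : z ∈ C) (hzP : z ∈ P)
    (hCK : ∀ x ∈ C, x ∈ P ∨ x ∈ Q → x = z) : False := by
  obtain ⟨c, k, T, t, hT, hdisj⟩ := h.exists_paths hC3
  have hPQ := h.disj
  obtain ⟨i, j, hij, hzi, hzj⟩ : ∃ i j, i ≠ j ∧ z ∉ T i ∧ z ∉ T j := by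
    have n1 : (0 : Fin 3) ≠ 1 := by decide
    have n2 : (0 : Fin 3) ≠ 2 := by decide
    have n3 : (1 : Fin 3) ≠ 2 := by decide
    have h1 := hdisj _ _ n1 z
    have h2 := hdisj _ _ n2 z
    have h3 := hdisj _ _ n3 z
    grind
  have key : ∀ i, z ∉ T i → k i ∉ P := by
    intro i hzi hi
    obtain ⟨i1, i2, i3, i4, i5⟩ := hT i
    have hc : z ≠ c i := by
      rintro rfl
      exact hzi i1.start_mem
    exact h.cycle_ear (hC.move h.lsymm hz i2 hc) (.nil z) i1 (by grind) i4 (by grind) i5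
      (by grind) (by grind) hzP hi
  have hi := key i hzi
  have hj := key j hzj
  obtain ⟨i1, i2, i3, i4, i5⟩ := hT i
  obtain ⟨j1, j2, j3, j4, j5⟩ := hT j
  have hd := hdisj i j hij
  have hi' := i1.end_mem
  have hj' := j1.end_mem
  have hi'' := i1.start_mem
  have hj'' := j1.start_mem
  obtain ⟨C₁, C₂, g₁, g₂, l1, l2, l3, l4, l5, l6⟩ := hC.move h.lsymm hz i2
    (by rintro rfl; exact hzi hi'')
  have main : ∀ {C₁ C₂ : Set V} {g₁ g₂ : ZMod 2}, IsLPath L C₁ z (c i) g₁ →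
      IsLPath L C₂ z (c i) g₂ → (∀ x, x ∈ C ↔ x ∈ C₁ ∨ x ∈ C₂) →
      (∀ x ∈ C₁, x ∈ C₂ → x = z ∨ x = c i) → g₁ ≠ g₂ → c j ∈ C₂ → False := by
    clear l1 l2 l3 l4 l6
    intro C₁ C₂ g₁ g₂ l1 l2 l3 l4 l6 hcj
    obtain ⟨A, B, a, b, m1, m2, m3, m4, m5⟩ := l2.split hcj
    have i6 := m1.start_mem
    have i7 := m2.end_mem
    -- This zero ear gives `t i + b + t j = 0`, so the prongs below differ by `g₁ + a + b = g₁ + g₂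
    -- ≠ 0`.
    have e1 := h.earQ ((i1.symm h.lsymm).trans ((m2.symm h.lsymm).trans j1 (by grind))
      (by grind)) (by grind) (by grind) (by grind) (by grind) (by grind)
    have hf : IsFork L P Q (C₁ ∪ T i) (A ∪ T j) z (k i) (k j) (g₁ + t i) (a + t j) :=
      ⟨⟨l1.trans i1 (by grind), hzP, by grind, by grind, by grind⟩,
        ⟨m1.trans j1 (by grind), hzP, by grind, by grind, by grind⟩, by grind, by grind⟩
    exact h.no_fork hf
  rcases (l3 (c j)).1 j2 with hcj | hcj
  · exact main l2 l1 (by grind) (by grind) l6.symm hcj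
  · exact main l1 l2 l3 l4 l6 hcj

/-- An inner vertex reaches the rest of `P ∪ Q` without `p` and `q`. Diverting one rung along such a
path preserves its label, since the detour is a zero ear, and leaves a fork. -/
theorem theta [Finite V] (h : ZeroLinkage M L x₁ y₁ x₂ y₂ P Q) (hR : IsRung L P Q R p q r)
    (hR' : IsRung L P Q R' p q r') (hRR' : ∀ x ∈ R, x ∈ R' → x = p ∨ x = q) (hr : r ≠ r')
    (hz : z ∈ R ∨ z ∈ R') (hzp : z ≠ p) (hzq : z ≠ q) : False := by
  have hne := h.ne
  have hx₁ := h.hP.start_mem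
  have hx₂ := h.hP.end_mem
  have hy₁ := h.hQ.start_mem
  have hy₂ := h.hQ.end_mem
  have hPQ := h.disj
  have key : ∀ {x₁ y₁ x₂ y₂ : V} {P Q R R' T : Set V} {p q s k : V} {r r' e : ZMod 2},
      ZeroLinkage M L x₁ y₁ x₂ y₂ P Q → IsRung L P Q R p q r → IsRung L P Q R' p q r' →
      (∀ x ∈ R, x ∈ R' → x = p ∨ x = q) → r ≠ r' → IsLPath L T s k e → s ∈ R →
      (∀ x ∈ T, x ∈ R ∨ x ∈ R' → x = s) → p ∉ T → q ∉ T →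
      (∀ x ∈ T, x ∈ P ∨ x ∈ Q → x = k) → k ∈ P → False := by
    clear * -
    intro x₁ y₁ x₂ y₂ P Q R R' T p q s k r r' e h hR hR' hRR' hr hT hs hTR hpT hqT hTK hk
    have hPQ := h.disj
    have hf' := hR'
    obtain ⟨h1, h2, h3, h4, h5⟩ := hR
    obtain ⟨A, B, a, b, l1, l2, l3, l4, l5⟩ := h1.split hs
    have i1 := l1.start_mem
    have i2 := l2.end_mem
    have i3 := hT.end_mem
    have i4 := hT.start_mem
    have e1 := h.earP (l1.trans hT (by grind)) (by grind) h2 hk (by grind) (by grind)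
    have hf : IsFork L Q P (B ∪ T) R' q k p (b + e) r' :=
      ⟨⟨(l2.symm h.lsymm).trans hT (by grind), h3, hk, by grind, by grind⟩,
        hf'.swap h.lsymm, by grind, by grind⟩
    exact h.swap.no_fork hf
  obtain ⟨v, hv, hvp, hvq⟩ : ∃ v, (v ∈ P ∨ v ∈ Q) ∧ v ≠ p ∧ v ≠ q := by
    have := hR.hp
    have := hR.hq
    by_cases hxp : x₁ = p
    · exact ⟨x₂, by grind⟩
    · exact ⟨x₁, by grind⟩
  obtain ⟨E, c, hE, hpE, hqE⟩ := h.conn p q z v hzp hzq hvp hvq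
  obtain ⟨s, k, T, f, h1, h2, h3, h4, h5, h6⟩ := hE.shorten h.symm
    (X := R ∪ R') (Y := P ∪ Q) hz hv
  have hT := h.lift h1 (by grind) (by grind)
  rcases h3 with h3 | h3 <;> rcases h4 with h4 | h4
  · exact key h hR hR' hRR' hr hT h3 h5 (by grind) (by grind) h6 h4
  · exact key h.swap (hR.swap h.lsymm) (hR'.swap h.lsymm) (by grind) hr hT h3 h5 (by grind)
      (by grind) (by grind) h4
  · exact key h hR' hR (by grind) hr.symm hT h3 (by grind) (by grind) (by grind) h6 h4
  · exact key h.swap (hR'.swap h.lsymm) (hR.swap h.lsymm) (by grind) hr.symm hT h3 (by grind)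
      (by grind) (by grind) (by grind) h4

/-- The path `E` contains a second rung whose label differs from `r`. Sharing both ends, one end or
none with `R`, it contradicts `theta`, `no_fork` or `rung_label_eq`. -/
theorem cycle_rung [Finite V] (h : ZeroLinkage M L x₁ y₁ x₂ y₂ P Q)
    (hC3 : 3 ≤ C.ncard) {E : Set V} {e : ZMod 2} (hR : IsRung L P Q R p q r)
    (hE : IsLPath L E p q e) (hRE : ∀ x ∈ R, x ∈ E → x = p ∨ x = q)
    (hC : ∀ x ∈ C, x ∈ R ∨ x ∈ E) (hre : e ≠ r) : False := by
  classical
  have hPQ := h.disj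
  have hp := hR.hp
  have hq := hR.hq
  -- For the potential `0` on `P` and `r` on `Q`, zero ears and rungs of label `r` are consistent,
  -- so the inconsistent piece is a rung of another label.
  obtain ⟨s, t, E₁, R', E₂, e₁, r', e₂, k1, k2, k3, k4, k5, k6, k7, k8, k9, k10, k11, k12, k13⟩ :=
    hE.exists_ear (K := P ∪ Q) (fun x => if x ∈ Q then r else 0) (.inl hp) (.inr hq) (by grind)
  have main : ∀ {p' q' : V}, IsRung L P Q R' p' q' r' → r ≠ r' → False := by
    intro p' q' hR' hrr
    have i1 := hR'.path.start_mem
    have i2 := hR'.path.end_mem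
    have i3 := hR.path.start_mem
    have i4 := hR.path.end_mem
    have i5 := hR'.memP
    have i6 := hR'.memQ
    by_cases hpp : p' = p <;> by_cases hqq : q' = q
    · subst hpp hqq
      obtain ⟨z, hz, hzp, hzq⟩ : ∃ z ∈ C, z ≠ p' ∧ z ≠ q' := by
        by_contra! hc
        have h1 : C ⊆ {p', q'} := fun x hx => by have := hc x hx; grind
        have h2 := Set.ncard_le_ncard h1 (Set.toFinite _)
        rw [Set.ncard_pair (by grind)] at h2
        omega
      have hzR : z ∈ R ∨ z ∈ R' := by
        have j1 := k1.start_mem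
        have j3 := k3.end_mem
        have hs : s = p' := by grind
        have ht : t = q' := by grind
        subst hs ht
        have := k1.eq_nil.1
        have := k3.eq_nil.1
        grind
      exact h.theta hR hR' (by grind) hrr hzR hzp hzq
    · subst hpp
      exact h.no_fork ⟨hR, hR', by grind, hrr⟩
    · subst hqq
      exact h.swap.no_fork ⟨hR.swap h.lsymm, hR'.swap h.lsymm, by grind, hrr⟩
    · exact hrr (h.rung_label_eq hR hR' (by grind))
  have := h.earP k2 k12
  have := h.earQ k2 k12
  rcases k9 with hs | hs <;> rcases k10 with ht | ht
  · grind
  · exact main (p' := s) (q' := t) ⟨k2, hs, ht, by grind, by grind⟩ (by grind)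
  · exact main (p' := t) (q' := s) ⟨k2.symm h.lsymm, ht, hs, by grind, by grind⟩ (by grind)
  · grind

/-- One arc is non-zero and therefore contains a non-zero piece between vertices of `P ∪ Q`. This is
a rung, and the rest of the cycle joins its ends with a different label. -/
theorem cycle_cross [Finite V] (h : ZeroLinkage M L x₁ y₁ x₂ y₂ P Q)
    (hC : NonzeroCycle L C u v) (hC3 : 3 ≤ C.ncard) (hu : u ∈ P ∨ u ∈ Q) (hv : v ∈ P ∨ v ∈ Q) :
    False := by
  have hPQ := h.disj
  obtain ⟨C₁, C₂, g₁, g₂, l1, l2, l3, l4, l5, l6⟩ := hC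
  have main : ∀ {C₁ C₂ : Set V} {g₁ g₂ : ZMod 2}, IsLPath L C₁ u v g₁ →
      IsLPath L C₂ u v g₂ → (∀ x, x ∈ C ↔ x ∈ C₁ ∨ x ∈ C₂) →
      (∀ x ∈ C₁, x ∈ C₂ → x = u ∨ x = v) → g₁ ≠ g₂ → g₁ ≠ 0 → False := by
    clear l1 l2 l3 l4 l6
    intro C₁ C₂ g₁ g₂ l1 l2 l3 l4 l6 hg
    obtain ⟨s, t, E₁, R, E₂, e₁, r, e₂, k1, k2, k3, k4, k5, k6, k7, k8, k9, k10, k11, k12, k13⟩ :=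
      l1.exists_ear (K := P ∪ Q) 0 hu hv (by simpa using hg)
    have i1 := k1.start_mem
    have i2 := k1.end_mem
    have i3 := k3.start_mem
    have i4 := k3.end_mem
    have hE := ((k1.symm h.lsymm).trans l2 (by grind)).trans (k3.symm h.lsymm) (by grind)
    have := h.earP k2 k12
    have := h.earQ k2 k12
    have : r ≠ 0 := by simpa using k13
    rcases k9 with hs | hs <;> rcases k10 with ht | ht
    · grind
    · exact h.cycle_rung hC3 ⟨k2, hs, ht, by grind, by grind⟩ hE (by grind) (by grind) (by grind)
    · exact h.cycle_rung hC3 ⟨k2.symm h.lsymm, ht, hs, by grind, by grind⟩ (hE.symm h.lsymm)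
        (by grind) (by grind) (by grind)
    · grind
  by_cases hg : g₁ = 0
  · exact main l2 l1 (by grind) (by grind) l6.symm (by grind)
  · exact main l1 l2 l3 l4 l6 hg

theorem no_cycle [Finite V] (h : ZeroLinkage M L x₁ y₁ x₂ y₂ P Q)
    (hC : NonzeroCycle L C u v) (hC3 : 3 ≤ C.ncard) : False := by
  by_cases h0 : ∃ z ∈ C, z ∈ P ∨ z ∈ Q
  · obtain ⟨z, hz, hzK⟩ := h0
    by_cases h1 : ∃ w ∈ C, (w ∈ P ∨ w ∈ Q) ∧ w ≠ z
    · obtain ⟨w, hw, hwK, hwz⟩ := h1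
      exact h.cycle_cross (hC.move h.lsymm hw hz hwz) hC3 hwK hzK
    · rcases hzK with hzP | hzQ
      · exact h.cycle_touch hC hC3 hz hzP (by grind)
      · exact h.swap.cycle_touch hC hC3 hz hzQ (by grind)
  · exact h.cycle_disjoint hC hC3 (by grind)

end ZeroLinkage

/-- If all linkages have the same label then there is no non-zero cycle of length at least
three. -/
theorem TwoEdges.no_cycle {V : Type*} [Finite V] {M L : V → V → ZMod 2 → Prop}
    {x₁ y₁ x₂ y₂ u v : V} {C : Set V} {c : ZMod 2} (h : TwoEdges M L x₁ y₁ x₂ y₂)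
    (hc : LinkConst L x₁ y₁ x₂ y₂ c) (hC : NonzeroCycle L C u v) (hC3 : 3 ≤ C.ncard) : False := by
  have key : ∀ {x₂ y₂ : V} {D E : Set V} {d e : ZMod 2}, TwoEdges M L x₁ y₁ x₂ y₂ →
      LinkConst L x₁ y₁ x₂ y₂ c → IsLPath L D x₁ x₂ d → IsLPath L E y₁ y₂ e → (∀ x ∈ D, x ∉ E) →
      False := by
    clear h hc
    intro x₂ y₂ D E d e h hc hD hE hDE
    obtain ⟨π₁, -, z₁⟩ := hD.exists_potential 0
    obtain ⟨π, e₂, z₂⟩ := hE.exists_potential π₁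
    obtain ⟨w₁, -⟩ := z₁ π (by grind)
    obtain ⟨w₂, -⟩ := z₂ π (by grind)
    have hlink := hc.switched π
    have h0 := hlink.1 _ ⟨_, _, _, _, zeroLinks_path w₁, zeroLinks_path w₂, hDE, rfl⟩
    rw [add_zero] at h0
    rw [← h0] at hlink
    have hZ : ZeroLinkage (_root_.switched M π) (_root_.switched L π) x₁ y₁ x₂ y₂ D E :=
      ⟨h.switched π, w₁, w₂, hDE, hlink⟩
    obtain ⟨C₁, C₂, g₁, g₂, l1, l2, l3, l4, l5, l6⟩ := hC
    exact hZ.no_cycle ⟨C₁, C₂, _, _, l1.switched π, l2.switched π, l3, l4, l5, by grind⟩ hC3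
  obtain ⟨D, s, t, g, hD, hdisj⟩ := h.hasDisjointPaths (A := {x₁, y₁}) (B := {x₂, y₂}) (k := 2)
    (by norm_num) (by rw [Set.ncard_pair h.ne.1]) (by rw [Set.ncard_pair h.ne.2.1])
  choose s' t' D' g' k1 k2 k3 k4 k5 k6 using
    fun i => (hD i).1.shorten h.symm (hD i).2.1 (hD i).2.2
  have hd : ∀ x ∈ D' 0, x ∉ D' 1 := fun x hx hx' =>
    hdisj 0 1 (by decide) x (k2 0 x hx) (k2 1 x hx')
  have hne := h.ne
  have hl : ∀ i, IsLPath L (D' i) (s' i) (t' i) (g' i) := by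
    intro i
    have := k5 i
    have := k6 i
    exact h.lift (k1 i) (by grind) (by grind)
  have l0 := hl 0
  have l1 := hl 1
  have hs0 := k3 0
  have hs1 := k3 1
  have ht0 := k4 0
  have ht1 := k4 1
  have hsne : s' 0 ≠ s' 1 := fun he => hd _ l0.start_mem (he ▸ l1.start_mem)
  have htne : t' 0 ≠ t' 1 := fun he => hd _ l0.end_mem (he ▸ l1.end_mem)
  generalize s' 0 = s₀ at *
  generalize s' 1 = s₁ at *
  generalize t' 0 = t₀ at *
  generalize t' 1 = t₁ at *
  simp only [Set.mem_insert_iff, Set.mem_singleton_iff] at hs0 hs1 ht0 ht1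
  -- Menger's theorem does not prescribe the pairing; both pairings reduce to `key`.
  rcases hs0 with rfl | rfl <;> rcases hs1 with rfl | rfl <;> rcases ht0 with rfl | rfl <;>
    rcases ht1 with rfl | rfl <;> try contradiction
  · exact key h hc l0 l1 hd
  · exact key h.swap_right hc.swap_right l0 l1 hd
  · exact key h.swap_right hc.swap_right l1 l0 (by grind)
  · exact key h hc l1 l0 (by grind)

/-! ### Without non-zero cycles, linkages have equal labels -/

/-- The links of `L` that have no parallel link with a different label. -/
def uniqueLinks {V : Type*} (L : V → V → ZMod 2 → Prop) : V → V → ZMod 2 → Prop :=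
  fun u v g => L u v g ∧ ¬ L u v (g + 1)

section

variable {V : Type*} {M L : V → V → ZMod 2 → Prop} {A B D E F₁ F₂ : Set V}
  {a b s t u v w x₁ y₁ x₂ y₂ : V} {g g' h k : ZMod 2}

theorem LSymm.uniqueLinks (hL : LSymm L) : LSymm (uniqueLinks L) :=
  fun _ _ _ h => ⟨hL h.1, fun h' => h.2 (hL h')⟩

/-- Paths are cut at common inner vertices. Internally disjoint paths with different labels would
form a forbidden cycle, or be parallel links with different labels. -/
theorem IsLPath.uniqueLinks_label (hC : ∀ C u v, NonzeroCycle L C u v → C.ncard < 3)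
    (hD : IsLPath (uniqueLinks L) D u v g) (hE : IsLPath (uniqueLinks L) E u v h) : g = h := by
  induction hn : D.ncard using Nat.strong_induction_on generalizing D E u v g h with
  | _ n ih =>
  subst hn
  have i1 := hD.start_mem
  have i2 := hD.end_mem
  have i3 := hE.start_mem
  have i4 := hE.end_mem
  by_cases huv : u = v
  · subst huv
    rw [hD.eq_nil.2, hE.eq_nil.2]
  by_cases hz : ∃ z ∈ D, z ∈ E ∧ z ≠ u ∧ z ≠ v
  · obtain ⟨z, hzD, hzE, hzu, hzv⟩ := hz
    obtain ⟨D₁, D₂, d₁, d₂, h1, h2, h3, h4, h5⟩ := hD.split hzD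
    obtain ⟨E₁, E₂, e₁, e₂, k1, k2, k3, k4, k5⟩ := hE.split hzE
    have j1 := h1.start_mem
    have j2 := h2.end_mem
    rw [h5, k5, ih _ _ h1 k1 rfl, ih _ _ h2 k2 rfl]
    · refine Set.ncard_lt_ncard ⟨fun x hx => by grind, fun hsub => ?_⟩ hD.finite
      have := hsub i1
      grind
    · refine Set.ncard_lt_ncard ⟨fun x hx => by grind, fun hsub => ?_⟩ hD.finite
      have := hsub i2
      grind
  by_contra hgh
  by_cases hw : ∃ w, (w ∈ D ∨ w ∈ E) ∧ w ≠ u ∧ w ≠ v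
  · obtain ⟨w, hw, hwu, hwv⟩ := hw
    have h1 := hC (D ∪ E) u v ⟨D, E, g, h, hD.mono' fun _ _ _ h => h.1,
      hE.mono' fun _ _ _ h => h.1, by grind, by grind, huv, hgh⟩
    have h2 := (Set.two_lt_ncard_iff (hD.finite.union hE.finite)).2
      ⟨u, v, w, .inl i1, .inl i2, hw, huv, hwu.symm, hwv.symm⟩
    omega
  · have h1 := hD.link_of_forall huv (by grind)
    have h2 := hE.link_of_forall huv (by grind)
    rw [ZMod.two_eq_add_one_of_ne hgh] at h1
    apply h1.2
    have : h + 1 + 1 = h := by grind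
    rw [this]
    exact h2.1

/-- Unlike in `IsLPath.concat`, the label survives: the detours cut off have zero label because
labels depend only on the ends. -/
theorem IsLPath.uniqueLinks_concat (hC : ∀ C u v, NonzeroCycle L C u v → C.ncard < 3)
    (hL : LSymm L) (hD : IsLPath (uniqueLinks L) D u w g) (hE : IsLPath (uniqueLinks L) E w v h) :
    ∃ C, IsLPath (uniqueLinks L) C u v (g + h) := by
  induction hD with
  | nil x => exact ⟨E, by simpa using hE⟩
  | @cons A x y z g g' hl hx hp ih =>
    obtain ⟨C, hC'⟩ := ih hE
    by_cases hxC : x ∈ C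
    · obtain ⟨C₁, C₂, g₁, g₂, h1, h2, -, -, h5⟩ := hC'.split hxC
      have hy := hp.start_mem
      have h6 := (single hl (by grind)).uniqueLinks_label hC (h1.symm hL.uniqueLinks)
      have h7 : g + g' + h = g₂ := by grind
      exact ⟨C₂, h7 ▸ h2⟩
    · exact ⟨insert x C, by rw [add_assoc]; exact cons hl hxC hC'⟩

theorem IsLPath.to_uniqueLinks (hD : IsLPath L D a b g)
    (h : ∀ u v F₁ F₂ g₀ f₁ f₂, L u v g₀ → IsLPath L F₁ a u f₁ → IsLPath L F₂ v b f₂ →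
      (∀ x, x ∈ D ↔ x ∈ F₁ ∨ x ∈ F₂) → (∀ x ∈ F₁, x ∉ F₂) → ¬ L u v (g₀ + 1)) :
    IsLPath (uniqueLinks L) D a b g := by
  induction hD with
  | nil x => exact .nil x
  | @cons A x y z g g' hl hx hp ih =>
    refine .cons ⟨hl, h x y {x} A g 0 g' hl (.nil x) hp (by grind) (by grind)⟩ hx (ih ?_)
    intro u v F₁ F₂ g₀ f₁ f₂ h1 h2 h3 h4 h5
    exact h u v (insert x F₁) F₂ g₀ _ f₂ h1 (cons hl (by grind) h2) h3 (by grind) (by grind)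

theorem IsLPath.exists_cross (hD : IsLPath L D s t g) (hs : s ∈ A) (ht : t ∉ A) :
    ∃ a b k, L a b k ∧ a ∈ A ∧ b ∉ A ∧ a ∈ D ∧ b ∈ D := by
  induction hD with
  | nil => exact absurd hs ht
  | @cons B x y z g g' hl hx hp ih =>
    by_cases hy : y ∈ A
    · obtain ⟨a, b, k, h1, h2, h3, h4, h5⟩ := ih hy ht
      exact ⟨a, b, k, h1, h2, h3, .inr h4, .inr h5⟩
    · exact ⟨x, y, g, hl, hs, hy, .inl rfl, .inr hp.start_mem⟩

namespace TwoEdges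

/-- Removing `u` and `b` cuts both crossing pairs, so nothing lies outside `A` but `b`. Then
removing `u` and `a` isolates `b` from a third vertex of `A`. -/
theorem no_two_cut (hM : TwoEdges M L x₁ y₁ x₂ y₂) {s₁ s₂ s₃ : V} (hu : u ∈ A) (ha : a ∈ A)
    (hb : b ∉ A) (hA : ∀ s ∈ A, ∀ t ∉ A, ∀ g, M s t g → s = u ∧ t = v ∨ s = a ∧ t = b)
    (hs₁ : s₁ ∈ A) (hs₂ : s₂ ∈ A) (hs₃ : s₃ ∈ A) (h₁₂ : s₁ ≠ s₂) (h₁₃ : s₁ ≠ s₃)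
    (h₂₃ : s₂ ≠ s₃) : False := by
  have hAc : ∀ t ∉ A, t = b := by
    by_contra! hc
    obtain ⟨t, ht, htb⟩ := hc
    obtain ⟨s, hs, hsu⟩ : ∃ s ∈ A, s ≠ u := by
      by_cases h : s₁ = u
      · exact ⟨s₂, by grind⟩
      · exact ⟨s₁, by grind⟩
    obtain ⟨D, g, hD, huD, hbD⟩ := hM.conn u b s t hsu (by grind) (by grind) htb
    obtain ⟨a', b', k, h1, h2, h3, h4, h5⟩ := hD.exists_cross hs ht
    have := hA a' h2 b' h3 k h1
    grind
  obtain ⟨s, hs, hsu, hsa⟩ : ∃ s ∈ A, s ≠ u ∧ s ≠ a := by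
    by_contra! hc
    have := hc s₁ hs₁
    have := hc s₂ hs₂
    have := hc s₃ hs₃
    by_cases s₁ = u <;> by_cases s₂ = u <;> grind
  obtain ⟨D, g, hD, huD, haD⟩ := hM.conn u a s b hsu hsa (by grind) (by grind)
  obtain ⟨a', b', k, h1, h2, h3, h4, h5⟩ := hD.exists_cross hs hb
  have := hA a' h2 b' h3 k h1
  grind

/-- With a parallel link of the other label, `u` and `v` are joined in `L` only by their links. Of
the two removed pairs only one can cross the resulting cut, since `E` keeps `y₁` and `y₂` on one
side; so `no_two_cut` applies. -/
theorem not_parallel (hM : TwoEdges M L x₁ y₁ x₂ y₂)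
    (hC : ∀ C u v, NonzeroCycle L C u v → C.ncard < 3) {f₁ f₂ e : ZMod 2}
    (hl : L u v g) (hF₁ : IsLPath L F₁ x₁ u f₁) (hF₂ : IsLPath L F₂ v x₂ f₂)
    (hE : IsLPath L E y₁ y₂ e) (hF : ∀ x ∈ F₁, x ∉ F₂) (hE₂ : ∀ x ∈ F₂, x ∉ E) : ¬ L u v (g + 1) := by
  intro hl'
  have hL := hM.lsymm
  have i1 := hF₁.end_mem
  have i2 := hF₂.start_mem
  have huv : u ≠ v := by grind
  -- A path with a third vertex would close to a non-zero cycle with one of the two parallel links.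
  have hpath : ∀ D k, IsLPath L D u v k → ∀ w ∈ D, w = u ∨ w = v := by
    intro D k hD w hw
    by_contra! hc
    have key : ∀ g', L u v g' → k ≠ g' → False := by
      intro g' hg' hk
      have j1 := hD.start_mem
      have j2 := hD.end_mem
      have h1 := hC D u v ⟨D, {u, v}, k, g', hD, IsLPath.single hg' huv, by grind, by grind, huv,
        hk⟩
      have h2 := (Set.two_lt_ncard_iff hD.finite).2
        ⟨u, v, w, j1, j2, hw, huv, hc.1.symm, hc.2.symm⟩
      omega
    by_cases hk : k = g
    · exact key _ hl' (by grind)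
    · exact key _ hl hk
  set A : Set V := {w | ∃ D k, IsLPath L D u w k ∧ v ∉ D} with hA
  have hstay : ∀ D a b k, IsLPath L D a b k → v ∉ D → a ∈ A → b ∈ A := by
    rintro D a b k hD hv ⟨E, k', hE, hvE⟩
    obtain ⟨C, c, hC, hsub⟩ := hE.concat hD
    exact ⟨C, c, hC, by grind⟩
  have hvA : v ∉ A := by
    rintro ⟨D, k, hD, hv⟩
    exact hv hD.end_mem
  have huA : u ∈ A := ⟨{u}, 0, .nil u, by grind⟩
  have hcross : ∀ a ∈ A, ∀ b ∉ A, ∀ k, L a b k → a = u ∧ b = v := by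
    intro a ha b hb k hk
    have hab : a ≠ b := by grind
    have hbv : b = v := by
      by_contra hbv
      exact hb (hstay _ _ _ _ (IsLPath.single hk hab) (by grind) ha)
    subst hbv
    obtain ⟨D, d, hD, hvD⟩ := ha
    have ha := hD.end_mem
    have := hpath _ _ (hD.trans (IsLPath.single hk hab) (by grind)) a (by grind)
    grind
  have hx₁ : x₁ ∈ A := ⟨F₁, f₁, hF₁.symm hL, by grind⟩
  have hx₂ : x₂ ∉ A := by
    intro hx₂
    obtain ⟨a, b, k, h1, h2, h3, h4, h5⟩ := (hF₂.symm hL).exists_cross hx₂ hvA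
    have := hcross a h2 b h3 k h1
    grind
  have hvE : v ∉ E := hE₂ v i2
  have hne := hM.ne
  have hMcross : ∀ a ∈ A, ∀ b ∉ A, ∀ k, M a b k → (a = u ∧ b = v) ∨ (a = x₁ ∧ b = y₁) ∨
      (a = y₂ ∧ b = x₂) := by
    intro a ha b hb k hk
    by_cases hLk : L a b k
    · exact .inl (hcross a ha b hb k hLk)
    · rw [hM.iff] at hLk
      grind
  by_cases hy₁ : y₁ ∈ A
  · have hy₂ : y₂ ∈ A := hstay E _ _ _ hE hvE hy₁
    exact hM.no_two_cut (v := v) huA hy₂ hx₂ (fun s hs t ht k hk => by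
      have := hMcross s hs t ht k hk
      grind) hx₁ hy₁ hy₂ (by grind) (by grind) (by grind)
  · have hy₂ : y₂ ∉ A := fun hy₂ => hy₁ (hstay E _ _ _ (hE.symm hL) hvE hy₂)
    exact hM.no_two_cut (A := Aᶜ) (u := v) (v := u) (a := y₁) (b := x₁) hvA hy₁ (by simpa using hx₁)
      (fun s hs t ht k hk => by
        have := hMcross t (by simpa using ht) s hs k (hM.symm hk)
        grind) hy₁ hy₂ hx₂ (by grind) (by grind) (by grind)

theorem linkage_unique (hM : TwoEdges M L x₁ y₁ x₂ y₂)
    (hC : ∀ C u v, NonzeroCycle L C u v → C.ncard < 3) (h : Linkage L x₁ y₁ x₂ y₂ g) :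
    Linkage (uniqueLinks L) x₁ y₁ x₂ y₂ g := by
  obtain ⟨D, E, d, e, h1, h2, h3, h4⟩ := h
  refine ⟨D, E, d, e, h1.to_uniqueLinks ?_, h2.to_uniqueLinks ?_, h3, h4⟩
  · intro u v F₁ F₂ g₀ f₁ f₂ k1 k2 k3 k4 k5
    exact hM.not_parallel hC k1 k2 k3 h2 k5 (by grind)
  · intro u v F₁ F₂ g₀ f₁ f₂ k1 k2 k3 k4 k5
    exact hM.swap.not_parallel hC k1 k2 k3 h1 k5 (by grind)

/-- If there is no non-zero cycle of length at least three, then all linkages have the same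
label. -/
theorem linkage_label_eq (hM : TwoEdges M L x₁ y₁ x₂ y₂)
    (hC : ∀ C u v, NonzeroCycle L C u v → C.ncard < 3)
    (h : Linkage L x₁ y₁ x₂ y₂ g ∨ Linkage L x₁ y₁ y₂ x₂ g)
    (h' : Linkage L x₁ y₁ x₂ y₂ g' ∨ Linkage L x₁ y₁ y₂ x₂ g') : g = g' := by
  have hU := hM.lsymm.uniqueLinks
  have same : ∀ {x₂ y₂ g g'}, Linkage (uniqueLinks L) x₁ y₁ x₂ y₂ g →
      Linkage (uniqueLinks L) x₁ y₁ x₂ y₂ g' → g = g' := by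
    rintro x₂ y₂ g g' ⟨D, E, d, e, h1, h2, -, h4⟩ ⟨D', E', d', e', k1, k2, -, k4⟩
    rw [h4, k4, h1.uniqueLinks_label hC k1, h2.uniqueLinks_label hC k2]
  have cross : ∀ {g g'}, Linkage (uniqueLinks L) x₁ y₁ x₂ y₂ g →
      Linkage (uniqueLinks L) x₁ y₁ y₂ x₂ g' → g = g' := by
    rintro g g' ⟨D, E, d, e, h1, h2, -, h4⟩ ⟨D', E', d', e', k1, k2, -, k4⟩
    -- Going from `y₁` to `x₂`, `x₁` and `y₂` along `E'`, `D`, `D'` has the label of `E`.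
    obtain ⟨C, hC₁⟩ := k2.uniqueLinks_concat hC hM.lsymm (h1.symm hU)
    obtain ⟨C', hC₂⟩ := hC₁.uniqueLinks_concat hC hM.lsymm k1
    have := h2.uniqueLinks_label hC hC₂
    grind
  rcases h with h | h <;> rcases h' with h' | h'
  · exact same (hM.linkage_unique hC h) (hM.linkage_unique hC h')
  · exact cross (hM.linkage_unique hC h) (hM.swap_right.linkage_unique hC h')
  · exact (cross (hM.linkage_unique hC h') (hM.swap_right.linkage_unique hC h)).symm
  · exact same (hM.swap_right.linkage_unique hC h) (hM.swap_right.linkage_unique hC h')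

end TwoEdges

end

/-! ### From walks in multigraphs to labelled relations and back -/

namespace Graph

namespace Walk

variable {α β : Type*} {G : Graph α β} {u v w a b : α} {e : β}

/-- Concatenation of walks. -/
def append : {u v w : α} → G.Walk u v → G.Walk v w → G.Walk u w
  | _, _, _, nil _, q => q
  | _, _, _, cons e h p, q => cons e h (append p q)

theorem edges_append : {u v w : α} → (p : G.Walk u v) → (q : G.Walk v w) →
    (p.append q).edges = p.edges ++ q.edges
  | _, _, _, nil _, _ => rfl
  | _, _, _, cons _ _ p, q => congrArg _ (edges_append p q)

theorem vertices_eq_cons : {u v : α} → (p : G.Walk u v) → p.vertices = u :: p.vertices.tail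
  | _, _, nil _ => rfl
  | _, _, cons _ _ _ => rfl

theorem start_mem (p : G.Walk u v) : u ∈ p.vertices := by
  rw [vertices_eq_cons]; simp

theorem end_mem : {u v : α} → (p : G.Walk u v) → v ∈ p.vertices
  | _, _, nil _ => List.mem_singleton_self _
  | _, _, cons _ _ p => List.mem_cons_of_mem _ (end_mem p)

theorem vertices_append : {u v w : α} → (p : G.Walk u v) → (q : G.Walk v w) →
    (p.append q).vertices = p.vertices ++ q.vertices.tail
  | _, _, _, nil _, q => vertices_eq_cons q
  | _, _, _, cons _ _ p, q => congrArg _ (vertices_append p q)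

theorem length_vertices : {u v : α} → (p : G.Walk u v) → p.vertices.length = p.edges.length + 1
  | _, _, nil _ => rfl
  | _, _, cons _ _ p => congrArg (· + 1) (length_vertices p)

theorem mem_vertexSet : {u v : α} → (p : G.Walk u v) → ∀ x ∈ p.vertices, x ∈ G.vertexSet
  | _, _, nil hx, x, h => by
    obtain rfl := List.mem_singleton.1 h
    exact hx
  | _, _, cons _ hl p, x, h => by
    rcases List.mem_cons.1 h with rfl | h
    · exact hl.left_mem
    · exact mem_vertexSet p x h

theorem eq_nil_of_isPath : {u : α} → (p : G.Walk u u) → p.IsPath → p.edges = []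
  | _, nil _, _ => rfl
  | _, cons _ _ p, h => absurd (end_mem p) (List.nodup_cons.1 h).1

/-- A walk splits at each of its edges. -/
theorem exists_split : {u v : α} → (p : G.Walk u v) → e ∈ p.edges →
    ∃ (a b : α) (q : G.Walk u a) (r : G.Walk b v), G.IsLink e a b ∧
      p.vertices = q.vertices ++ r.vertices ∧ p.edges = q.edges ++ e :: r.edges
  | _, _, nil _, h => absurd h List.not_mem_nil
  | _, _, cons f hl p, h => by
    by_cases hef : e = f
    · subst hef
      exact ⟨_, _, nil hl.left_mem, p, hl, rfl, rfl⟩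
    · obtain ⟨a, b, q, r, h1, h2, h3⟩ := exists_split p ((List.mem_cons.1 h).resolve_left hef)
      exact ⟨a, b, cons f hl q, r, h1, congrArg _ h2, congrArg _ h3⟩

theorem ends_mem (p : G.Walk u v) (h : e ∈ p.edges) (hl : G.IsLink e a b) : a ∈ p.vertices := by
  obtain ⟨c, d, q, r, h1, h2, -⟩ := p.exists_split h
  rw [h2]
  rcases hl.left_eq_or_eq h1 with rfl | rfl
  · exact List.mem_append_left _ q.end_mem
  · exact List.mem_append_right _ r.start_mem

/-- Only a path of length one contains an edge between its ends. -/
theorem length_of_link_ends (p : G.Walk u v) (hp : p.IsPath) (h : e ∈ p.edges)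
    (hl : G.IsLink e u v) : p.length = 1 := by
  obtain ⟨c, d, q, r, h1, h2, h3⟩ := p.exists_split h
  rw [IsPath, h2, List.nodup_append'] at hp
  obtain ⟨hq, hr, hd⟩ := hp
  rcases hl.eq_and_eq_or_eq_and_eq h1 with ⟨rfl, rfl⟩ | ⟨rfl, rfl⟩
  · rw [length, h3, eq_nil_of_isPath q hq, eq_nil_of_isPath r hr]
    rfl
  · exact (hd q.start_mem r.start_mem).elim

theorem map_label {Γ : Type*} [AddGroup Γ] (ψ : β → Γ) (f : Γ →+ ZMod 2) (p : G.Walk u v) :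
    p.label (fun e => f (ψ e)) = f (p.label ψ) := by
  simp only [label, map_list_sum, List.map_map]
  rfl

end Walk

/-- The labelled adjacency relation of `H` on a set `W` of vertices. -/
def labelRel {α β : Type*} (W : Set α) (H : Graph α β) (φ : β → ZMod 2) :
    W → W → ZMod 2 → Prop :=
  fun u v g => ∃ e, H.IsLink e u v ∧ φ e = g

section

variable {α β : Type*} {G H : Graph α β} {W : Set α} {φ : β → ZMod 2}

theorem Walk.isLPath : {u v : α} → (p : H.Walk u v) → (hp : p.IsPath) →
    (hW : ∀ x ∈ p.vertices, x ∈ W) → (hu : u ∈ W) → (hv : v ∈ W) →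
    IsLPath (labelRel W H φ) {x : W | (x : α) ∈ p.vertices} ⟨u, hu⟩ ⟨v, hv⟩ (p.label φ)
  | u, _, nil hx, hp, hW, hu, hv => by
    have : {x : W | (x : α) ∈ (Walk.nil hx : H.Walk u u).vertices} = {⟨u, hu⟩} := by
      ext x
      simp [Walk.vertices, Subtype.ext_iff]
    rw [this]
    exact .nil _
  | u, v, cons (y := y) e hl p, hp, hW, hu, hv => by
    have h1 := List.nodup_cons.1 hp
    have hy : y ∈ W := hW y (List.mem_cons_of_mem _ p.start_mem)
    have h2 := isLPath p h1.2 (fun x hx => hW x (List.mem_cons_of_mem _ hx)) hy hv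
    have h3 : {x : W | (x : α) ∈ (Walk.cons e hl p).vertices} =
        insert ⟨u, hu⟩ {x : W | (x : α) ∈ p.vertices} := by
      ext x
      simp [Walk.vertices, Subtype.ext_iff]
    have h4 : (Walk.cons e hl p).label φ = φ e + p.label φ := by
      simp [Walk.label, Walk.edges]
    rw [h3, h4]
    exact .cons ⟨e, hl, rfl⟩ h1.1 h2

theorem _root_.IsLPath.exists_walk (hW : W ⊆ H.vertexSet) {D : Set W} {u v : W} {g : ZMod 2}
    (hD : IsLPath (labelRel W H φ) D u v g) :
    ∃ p : H.Walk (u : α) v, p.IsPath ∧ (∀ x, x ∈ p.vertices ↔ ∃ h : x ∈ W, ⟨x, h⟩ ∈ D) ∧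
      p.label φ = g := by
  induction hD with
  | nil x =>
    refine ⟨.nil (hW x.2), by simp [Walk.IsPath, Walk.vertices], fun y => ?_, rfl⟩
    simp only [Walk.vertices, List.mem_singleton, Set.mem_singleton_iff, Subtype.ext_iff]
    exact ⟨fun h => ⟨h ▸ x.2, h⟩, fun ⟨_, h⟩ => h⟩
  | @cons A x y z g g' hl hx hp ih =>
    obtain ⟨e, he, rfl⟩ := hl
    obtain ⟨p, h1, h2, rfl⟩ := ih
    refine ⟨.cons e he p, List.nodup_cons.2 ⟨fun h => ?_, h1⟩, fun w => ?_, ?_⟩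
    · obtain ⟨_, h⟩ := (h2 _).1 h
      exact hx h
    · simp only [Walk.vertices, List.mem_cons, h2, Set.mem_insert_iff, Subtype.ext_iff]
      exact ⟨fun h => h.elim (fun h => ⟨h ▸ x.2, .inl h⟩) fun ⟨h, h'⟩ => ⟨h, .inr h'⟩,
        fun ⟨h, h'⟩ => h'.elim .inl fun h' => .inr ⟨h, h'⟩⟩
    · simp [Walk.label, Walk.edges]

theorem labelRel_symm : LSymm (labelRel W H φ) := fun _ _ _ ⟨e, he, hg⟩ => ⟨e, he.symm, hg⟩

theorem Walk.ncard_vertices {u v : α} (p : H.Walk u v) (hp : p.IsPath)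
    (hW : ∀ x ∈ p.vertices, x ∈ W) : {x : W | (x : α) ∈ p.vertices}.ncard = p.length + 1 := by
  classical
  rw [← Set.ncard_image_of_injective _ Subtype.val_injective, Walk.length,
    ← Walk.length_vertices, ← List.toFinset_card_of_nodup hp, ← Set.ncard_coe_finset]
  congr 1
  ext x
  simp only [Set.mem_image, Set.mem_ofPred_eq, Subtype.exists, exists_and_left, exists_prop,
    exists_eq_right_right, List.coe_toFinset]
  exact ⟨fun h => h.1, fun h => ⟨h, hW x h⟩⟩

/-- A non-zero cycle walk of length at least three gives two internally disjoint paths with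
different labels. -/
theorem Walk.IsCycle.nonzeroCycle {u : α} {p : H.Walk u u} (hp : p.IsCycle)
    (hW : ∀ x ∈ p.vertices, x ∈ W) (h3 : 3 ≤ p.length) (h0 : p.label φ ≠ 0) :
    ∃ C u v, NonzeroCycle (labelRel W H φ) C u v ∧ 3 ≤ C.ncard := by
  cases p with
  | nil => simp [Walk.length, Walk.edges] at h3
  | @cons _ y _ e hl p =>
    obtain ⟨-, h2, -⟩ := hp
    have hpp : p.IsPath := h2
    have hW' : ∀ x ∈ p.vertices, x ∈ W := fun x hx => hW x (List.mem_cons_of_mem _ hx)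
    have hlen : 2 ≤ p.length := by
      simp only [Walk.length, Walk.edges, List.length_cons] at h3 ⊢
      omega
    have hy := hW' y p.start_mem
    have hu := hW' u p.end_mem
    have hyu : y ≠ u := by
      rintro rfl
      simp [Walk.length, Walk.eq_nil_of_isPath p hpp] at hlen
    have hlab : (Walk.cons e hl p).label φ = φ e + p.label φ := by
      simp [Walk.label, Walk.edges]
    rw [hlab] at h0
    refine ⟨{x : W | (x : α) ∈ p.vertices}, ⟨y, hy⟩, ⟨u, hu⟩, ⟨_, {⟨y, hy⟩, ⟨u, hu⟩}, _, φ e,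
      p.isLPath hpp hW' hy hu, IsLPath.single ⟨e, hl.symm, rfl⟩ ?_, ?_, by grind, ?_, by grind⟩, ?_⟩
    · simpa using hyu
    · intro x
      refine ⟨.inl, ?_⟩
      rintro (h | rfl | rfl)
      · exact h
      · exact p.start_mem
      · exact p.end_mem
    · simpa using hyu
    · rw [Walk.ncard_vertices p hpp hW']
      omega

theorem _root_.NonzeroCycle.exists_isCycle (hW : W ⊆ H.vertexSet) {C : Set W} {u v : W}
    (hC : NonzeroCycle (labelRel W H φ) C u v) (h3 : 3 ≤ C.ncard) :
    ∃ (w : α) (p : H.Walk w w), p.IsCycle ∧ 3 ≤ p.length ∧ p.label φ ≠ 0 := by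
  obtain ⟨C₁, C₂, g₁, g₂, l1, l2, l3, l4, l5, l6⟩ := hC
  cases l1 with
  | nil => exact absurd rfl l5
  | @cons A _ y _ g g' hl hx hp =>
    have i1 := hp.start_mem
    have i2 := hp.end_mem
    have i3 := l2.start_mem
    have hD := hp.trans (l2.symm labelRel_symm) (by grind)
    have hAC : A ∪ C₂ = C := by
      ext x
      grind
    rw [hAC] at hD
    obtain ⟨p, h1, h2, h4⟩ := hD.exists_walk hW
    obtain ⟨e, he, rfl⟩ := hl
    have hset : {x : W | (x : α) ∈ p.vertices} = C := by
      ext x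
      simp [h2]
    have hpW : ∀ x ∈ p.vertices, x ∈ W := fun x hx => ((h2 x).1 hx).1
    have hlen := Walk.ncard_vertices p h1 hpW
    rw [hset] at hlen
    refine ⟨u, .cons e he p, ⟨?_, h1, ?_⟩, ?_, ?_⟩
    · simp only [Walk.length, Walk.edges, List.length_cons] at hlen ⊢
      omega
    · intro heq
      -- If the closing edge were also the last one, it would lie on a path whose ends it joins,
      -- forcing length one.
      have hmem : e ∈ p.edges := by
        have hne : p.edges ≠ [] := by
          intro h
          rw [Walk.length, h, List.length_nil] at hlen
          omega
        simp only [Walk.edges, List.head?_cons] at heq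
        rw [List.getLast?_cons, Option.some_inj, List.getLast?_eq_some_getLast hne,
          Option.getD_some] at heq
        rw [heq]
        exact List.getLast_mem hne
      have := p.length_of_link_ends h1 hmem he.symm
      omega
    · simp only [Walk.length, Walk.edges, List.length_cons] at hlen ⊢
      omega
    · have hlab : (Walk.cons e he p).label φ = φ e + p.label φ := by
        simp [Walk.label, Walk.edges]
      rw [hlab, h4]
      grind

end

end Graph

namespace Graph

variable {α β : Type*} {G : Graph α β} {φ : β → ZMod 2} {e₁ e₂ : β} {x₁ y₁ x₂ y₂ : α}

theorem deleteParallel_isLink {e : β} {u v : α} : (G.deleteParallel x₁ y₁ x₂ y₂).IsLink e u v ↔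
    G.IsLink e u v ∧ ¬ (u = x₁ ∧ v = y₁) ∧ ¬ (u = y₁ ∧ v = x₁) ∧
      ¬ (u = x₂ ∧ v = y₂) ∧ ¬ (u = y₂ ∧ v = x₂) := by
  rw [deleteParallel, deleteEdges_isLink]
  refine and_congr_right fun h => ?_
  simp only [Set.mem_ofPred_eq, h.isLink_iff]
  grind

theorem vertexSet_deleteParallel : (G.deleteParallel x₁ y₁ x₂ y₂).vertexSet = G.vertexSet := rfl

theorem twoEdges [G.Loopless] (hG : G.IsTriconnected) (φ : β → ZMod 2)
    (hx₁ : x₁ ∈ G.vertexSet) (hy₁ : y₁ ∈ G.vertexSet) (hx₂ : x₂ ∈ G.vertexSet)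
    (hy₂ : y₂ ∈ G.vertexSet)
    (hne : x₁ ≠ y₁ ∧ x₂ ≠ y₂ ∧ x₁ ≠ x₂ ∧ x₁ ≠ y₂ ∧ y₁ ≠ x₂ ∧ y₁ ≠ y₂) :
    TwoEdges (labelRel G.vertexSet G φ)
      (labelRel G.vertexSet (G.deleteParallel x₁ y₁ x₂ y₂) φ)
      ⟨x₁, hx₁⟩ ⟨y₁, hy₁⟩ ⟨x₂, hx₂⟩ ⟨y₂, hy₂⟩ where
  symm := labelRel_symm
  irr := fun u g ⟨e, he, _⟩ => he.ne rfl
  iff := by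
    intro u v g
    simp only [labelRel, deleteParallel_isLink, Subtype.ext_iff]
    grind
  conn := by
    intro a b u v hua hub hva hvb
    have h1 := hG.2 {(a : α), (b : α)}
    simp only [IsVertexCut, not_and, not_not] at h1
    have h2 := h1 (by
      rintro x (rfl | rfl)
      exacts [a.2, b.2]) (by
      refine (Set.encard_insert_le _ _).trans ?_
      rw [Set.encard_singleton]
      norm_num)
    obtain ⟨p, hp⟩ := h2 u (by simp [Subtype.ext_iff] at *; tauto) v
      (by simp [Subtype.ext_iff] at *; tauto)
    have hpV := p.mem_vertexSet
    rw [vertexSet_deleteVerts] at hpV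
    refine ⟨_, _, (p.isLPath (φ := φ) hp (fun x hx => (hpV x hx).1) u.2 v.2).mono' ?_, ?_, ?_⟩
    · rintro s t g ⟨e, he, hg⟩
      exact ⟨e, ((deleteVerts_isLink _ _).1 he).1, hg⟩
    · intro ha
      exact (hpV a ha).2 (by simp)
    · intro hb
      exact (hpV b hb).2 (by simp)
  ne := by simpa [Subtype.ext_iff] using hne

/-- A linkage closes up to a cycle through both edges. -/
theorem exists_isCycle_of_linkage (h₁ : G.IsLink e₁ x₁ y₁) (h₂ : G.IsLink e₂ x₂ y₂)
    (hne : x₁ ≠ y₁ ∧ x₂ ≠ y₂ ∧ x₁ ≠ x₂ ∧ x₁ ≠ y₂ ∧ y₁ ≠ x₂ ∧ y₁ ≠ y₂) {g : ZMod 2}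
    (h : Linkage (labelRel G.vertexSet G φ) ⟨x₁, h₁.left_mem⟩ ⟨y₁, h₁.right_mem⟩
      ⟨x₂, h₂.left_mem⟩ ⟨y₂, h₂.right_mem⟩ g) :
    ∃ (u : α) (C : G.Walk u u), C.IsCycle ∧ e₁ ∈ C.edges ∧ e₂ ∈ C.edges ∧
      C.label φ = g + φ e₁ + φ e₂ := by
  obtain ⟨D, E, d, e, hD, hE, hDE, rfl⟩ := h
  obtain ⟨p, p1, p2, rfl⟩ := hD.exists_walk subset_rfl
  obtain ⟨q, q1, q2, rfl⟩ := (hE.symm labelRel_symm).exists_walk subset_rfl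
  have hpq : ∀ x ∈ p.vertices, x ∉ q.vertices := by
    intro x hx hx'
    obtain ⟨i1, i2⟩ := (p2 x).1 hx
    obtain ⟨j1, j2⟩ := (q2 x).1 hx'
    exact hDE _ i2 j2
  have hedges : (Walk.cons e₁ h₁.symm (p.append (.cons e₂ h₂ q))).edges =
      e₁ :: (p.edges ++ e₂ :: q.edges) := by
    rw [Walk.edges, Walk.edges_append, Walk.edges]
  refine ⟨y₁, .cons e₁ h₁.symm (p.append (.cons e₂ h₂ q)), ⟨?_, ?_, ?_⟩, ?_, ?_, ?_⟩
  · rw [Walk.length, hedges]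
    simp
    omega
  · rw [Walk.vertices, List.tail_cons, Walk.vertices_append, Walk.vertices, List.tail_cons,
      List.nodup_append']
    exact ⟨p1, q1, fun x hx hx' => hpq x hx hx'⟩
  · rw [hedges, ← List.cons_append, List.getLast?_append_of_ne_nil _ (by simp), List.head?_append]
    intro heq
    have hmem : e₁ ∈ e₂ :: q.edges := by
      apply List.mem_of_getLast?
      rw [← heq]
      simp
    rcases List.mem_cons.1 hmem with rfl | hmem
    · have := h₁.eq_and_eq_or_eq_and_eq h₂
      grind
    · exact hpq x₁ p.start_mem (q.ends_mem hmem h₁)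
  · simp [hedges]
  · simp [hedges]
  · rw [Walk.label, hedges]
    simp only [List.map_cons, List.map_append, List.sum_cons, List.sum_append, Walk.label]
    ring

/-- Cutting the cycle open at `e₁` leaves a path, and cutting that at `e₂` leaves two disjoint
paths. The directions in which the edges are traversed decide the pairing. -/
theorem exists_linkage_of_isCycle (h₁ : G.IsLink e₁ x₁ y₁) (h₂ : G.IsLink e₂ x₂ y₂)
    (hne : x₁ ≠ y₁ ∧ x₂ ≠ y₂ ∧ x₁ ≠ x₂ ∧ x₁ ≠ y₂ ∧ y₁ ≠ x₂ ∧ y₁ ≠ y₂) {u : α} {C : G.Walk u u}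
    (hC : C.IsCycle) (he₁ : e₁ ∈ C.edges) (he₂ : e₂ ∈ C.edges) :
    ∃ g, (Linkage (labelRel G.vertexSet G φ) ⟨x₁, h₁.left_mem⟩ ⟨y₁, h₁.right_mem⟩
        ⟨x₂, h₂.left_mem⟩ ⟨y₂, h₂.right_mem⟩ g ∨
      Linkage (labelRel G.vertexSet G φ) ⟨x₁, h₁.left_mem⟩ ⟨y₁, h₁.right_mem⟩
        ⟨y₂, h₂.right_mem⟩ ⟨x₂, h₂.left_mem⟩ g) ∧ C.label φ = g + φ e₁ + φ e₂ := by
  have he : e₂ ≠ e₁ := by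
    rintro rfl
    have := h₁.eq_and_eq_or_eq_and_eq h₂
    grind
  obtain ⟨a, b, p, q, hl, hv, hE⟩ := C.exists_split he₁
  have htail : (q.append p).IsPath := by
    have h1 := hC.2.1
    rw [hv, p.vertices_eq_cons, List.cons_append, List.tail_cons] at h1
    rw [Walk.IsPath, Walk.vertices_append]
    exact List.nodup_append_comm.1 h1
  have he₂' : e₂ ∈ (q.append p).edges := by
    rw [hE] at he₂
    rw [Walk.edges_append]
    simp only [List.mem_append, List.mem_cons] at he₂ ⊢
    tauto
  obtain ⟨c, d, r, s, hl', hv', hE'⟩ := (q.append p).exists_split he₂'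
  have hlab : C.label φ = r.label φ + s.label φ + φ e₁ + φ e₂ := by
    have h1 : (q.append p).label φ = q.label φ + p.label φ := by
      simp [Walk.label, Walk.edges_append]
    have h2 : (q.append p).label φ = r.label φ + (φ e₂ + s.label φ) := by
      simp [Walk.label, hE']
    have h3 : C.label φ = p.label φ + (φ e₁ + q.label φ) := by
      simp [Walk.label, hE]
    rw [h3]
    linear_combination h2 - h1
  rw [Walk.IsPath, hv', List.nodup_append'] at htail
  obtain ⟨hr, hs, hrs⟩ := htail
  have pr := r.isLPath (φ := φ) hr r.mem_vertexSet (r.mem_vertexSet _ r.start_mem)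
    (r.mem_vertexSet _ r.end_mem)
  have ps := s.isLPath (φ := φ) hs s.mem_vertexSet (s.mem_vertexSet _ s.start_mem)
    (s.mem_vertexSet _ s.end_mem)
  have hd : ∀ x ∈ {x : G.vertexSet | (x : α) ∈ r.vertices},
      x ∉ {x : G.vertexSet | (x : α) ∈ s.vertices} := fun x hx hx' => hrs hx hx'
  refine ⟨r.label φ + s.label φ, ?_, hlab⟩
  rcases h₁.eq_and_eq_or_eq_and_eq hl with ⟨rfl, rfl⟩ | ⟨rfl, rfl⟩ <;>
    rcases h₂.eq_and_eq_or_eq_and_eq hl' with ⟨rfl, rfl⟩ | ⟨rfl, rfl⟩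
  · exact .inr ⟨_, _, _, _, ps.symm labelRel_symm, pr, fun x hx hx' => hd x hx' hx, add_comm _ _⟩
  · exact .inl ⟨_, _, _, _, ps.symm labelRel_symm, pr, fun x hx hx' => hd x hx' hx, add_comm _ _⟩
  · exact .inl ⟨_, _, _, _, pr, ps.symm labelRel_symm, hd, rfl⟩
  · exact .inr ⟨_, _, _, _, pr, ps.symm labelRel_symm, hd, rfl⟩

end Graph

/-! ### Reduction to `ZMod 2` and conclusion -/

/-- Linkages of the whole graph avoid the removed links. -/
theorem TwoEdges.linkage_lift {V : Type*} {M L : V → V → ZMod 2 → Prop} {x₁ y₁ x₂ y₂ : V}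
    {g : ZMod 2} (h : TwoEdges M L x₁ y₁ x₂ y₂)
    (hl : Linkage M x₁ y₁ x₂ y₂ g ∨ Linkage M x₁ y₁ y₂ x₂ g) :
    Linkage L x₁ y₁ x₂ y₂ g ∨ Linkage L x₁ y₁ y₂ x₂ g := by
  rcases hl with ⟨D, E, d, e, h1, h2, h3, h4⟩ | ⟨D, E, d, e, h1, h2, h3, h4⟩
  all_goals
    have i1 := h1.start_mem
    have i2 := h1.end_mem
    have i3 := h2.start_mem
    have i4 := h2.end_mem
  · exact .inl ⟨D, E, d, e, h.lift h1 (by grind) (by grind), h.lift h2 (by grind) (by grind), h3,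
      h4⟩
  · exact .inr ⟨D, E, d, e, h.lift h1 (by grind) (by grind), h.lift h2 (by grind) (by grind), h3,
      h4⟩

theorem Linkage.mono {V : Type*} {L L' : V → V → ZMod 2 → Prop} {x₁ y₁ x₂ y₂ : V}
    {g : ZMod 2} (h : Linkage L x₁ y₁ x₂ y₂ g) (hL : ∀ u v g, L u v g → L' u v g) :
    Linkage L' x₁ y₁ x₂ y₂ g := by
  obtain ⟨D, E, d, e, h1, h2, h3, h4⟩ := h
  exact ⟨D, E, d, e, h1.mono' hL, h2.mono' hL, h3, h4⟩

/-- Exponent two makes `Γ` a vector space over `ZMod 2`, and linear functionals separate its points.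
-/
theorem exists_addMonoidHom_ne_zero {Γ : Type*} [AddGroup Γ] (hΓ : ∀ a : Γ, a + a = 0) {x : Γ}
    (hx : x ≠ 0) : ∃ f : Γ →+ ZMod 2, f x ≠ 0 := by
  let _ : AddCommGroup Γ :=
    { ‹AddGroup Γ› with
      add_comm := fun a b => by
        have h := hΓ (a + b)
        have h1 : -(a + b) = a + b := neg_eq_of_add_eq_zero_left h
        have h2 : -a = a := neg_eq_of_add_eq_zero_left (hΓ a)
        have h3 : -b = b := neg_eq_of_add_eq_zero_left (hΓ b)
        rw [← h1, neg_add_rev, h2, h3] }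
  let _ : Module (ZMod 2) Γ := AddCommGroup.zmodModule fun a => by rw [two_nsmul]; exact hΓ a
  by_contra! hc
  exact hx ((Module.forall_dual_apply_eq_zero_iff (ZMod 2) x).1 fun f => hc f.toAddMonoidHom)

theorem mainTheorem4 {α β Γ : Type*} [AddGroup Γ] (hΓ : ∀ a : Γ, a + a = 0)
    (G : Graph α β) (hV : G.vertexSet.Finite) (hE : G.edgeSet.Finite) [G.Loopless]
    (hG : G.IsTriconnected) (ψ : β → Γ)
    (e₁ e₂ : β) (x₁ y₁ x₂ y₂ : α) (h₁ : G.IsLink e₁ x₁ y₁) (h₂ : G.IsLink e₂ x₂ y₂)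
    (hdisj : Disjoint ({x₁, y₁} : Set α) {x₂, y₂}) :
    (∃ (u v : α) (C₁ : G.Walk u u) (C₂ : G.Walk v v),
        C₁.IsCycle ∧ e₁ ∈ C₁.edges ∧ e₂ ∈ C₁.edges ∧
        C₂.IsCycle ∧ e₁ ∈ C₂.edges ∧ e₂ ∈ C₂.edges ∧
        C₁.label ψ ≠ C₂.label ψ) ↔
      ∃ (u : α) (C : (G.deleteParallel x₁ y₁ x₂ y₂).Walk u u),
        C.IsCycle ∧ 3 ≤ C.length ∧ C.label ψ ≠ 0 := by
  have hne : x₁ ≠ y₁ ∧ x₂ ≠ y₂ ∧ x₁ ≠ x₂ ∧ x₁ ≠ y₂ ∧ y₁ ≠ x₂ ∧ y₁ ≠ y₂ := by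
    have := h₁.ne
    have := h₂.ne
    simp only [Set.disjoint_left, Set.mem_insert_iff, Set.mem_singleton_iff] at hdisj
    grind
  have hT := fun φ : β → ZMod 2 =>
    Graph.twoEdges hG φ h₁.left_mem h₁.right_mem h₂.left_mem h₂.right_mem hne
  constructor
  · rintro ⟨u, v, C₁, C₂, c1, c2, c3, d1, d2, d3, hlab⟩
    obtain ⟨f, hf⟩ := exists_addMonoidHom_ne_zero hΓ (sub_ne_zero.2 hlab)
    by_contra! hno
    have hT := hT fun e => f (ψ e)
    obtain ⟨g, hg, hg'⟩ := Graph.exists_linkage_of_isCycle (φ := fun e => f (ψ e)) h₁ h₂ hne c1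
      c2 c3
    obtain ⟨k, hk, hk'⟩ := Graph.exists_linkage_of_isCycle (φ := fun e => f (ψ e)) h₁ h₂ hne d1
      d2 d3
    have := hT.linkage_label_eq (fun C u v hC => by
      by_contra! h3
      obtain ⟨w, p, p1, p2, p3⟩ := hC.exists_isCycle
        Graph.vertexSet_deleteParallel.symm.subset h3
      apply p3
      rw [Graph.Walk.map_label, hno w p p1 p2, map_zero]) (hT.linkage_lift hg) (hT.linkage_lift hk)
    rw [Graph.Walk.map_label] at hg' hk'
    apply hf
    rw [map_sub, hg', hk', this, sub_self]
  · rintro ⟨u, C, hC, h3, h0⟩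
    obtain ⟨f, hf⟩ := exists_addMonoidHom_ne_zero hΓ h0
    have hT := hT fun e => f (ψ e)
    by_contra! hno
    have := hV.to_subtype
    rw [← Graph.Walk.map_label] at hf
    obtain ⟨C', a, b, hC', hC3⟩ := hC.nonzeroCycle (W := G.vertexSet)
      (fun x hx => C.mem_vertexSet x hx) h3 hf
    have cyc : ∀ g, Linkage (Graph.labelRel G.vertexSet (G.deleteParallel x₁ y₁ x₂ y₂)
          fun e => f (ψ e)) ⟨x₁, h₁.left_mem⟩ ⟨y₁, h₁.right_mem⟩ ⟨x₂, h₂.left_mem⟩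
          ⟨y₂, h₂.right_mem⟩ g ∨ Linkage (Graph.labelRel G.vertexSet
          (G.deleteParallel x₁ y₁ x₂ y₂) fun e => f (ψ e)) ⟨x₁, h₁.left_mem⟩ ⟨y₁, h₁.right_mem⟩
          ⟨y₂, h₂.right_mem⟩ ⟨x₂, h₂.left_mem⟩ g →
        ∃ (u : α) (C : G.Walk u u), C.IsCycle ∧ e₁ ∈ C.edges ∧ e₂ ∈ C.edges ∧
          f (C.label ψ) = g + f (ψ e₁) + f (ψ e₂) := by
      intro g hg
      have hLM := fun u v g hl => ((hT.iff u v g).1 hl).1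
      simp only [← Graph.Walk.map_label]
      rcases hg with hg | hg
      · exact Graph.exists_isCycle_of_linkage h₁ h₂ hne (hg.mono hLM)
      · exact Graph.exists_isCycle_of_linkage h₁ h₂.symm (by grind) (hg.mono hLM)
    have same : ∀ g g', _ → _ → g = g' := fun g g' hg hg' => by
      obtain ⟨u, C, c1, c2, c3, c4⟩ := cyc g hg
      obtain ⟨v, D, d1, d2, d3, d4⟩ := cyc g' hg'
      rw [hno u v C D c1 c2 c3 d1 d2 d3, d4] at c4
      grind
    by_cases hex : ∃ g, Linkage (Graph.labelRel G.vertexSet (G.deleteParallel x₁ y₁ x₂ y₂)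
          fun e => f (ψ e)) ⟨x₁, h₁.left_mem⟩ ⟨y₁, h₁.right_mem⟩ ⟨x₂, h₂.left_mem⟩
          ⟨y₂, h₂.right_mem⟩ g ∨ Linkage (Graph.labelRel G.vertexSet
          (G.deleteParallel x₁ y₁ x₂ y₂) fun e => f (ψ e)) ⟨x₁, h₁.left_mem⟩ ⟨y₁, h₁.right_mem⟩
          ⟨y₂, h₂.right_mem⟩ ⟨x₂, h₂.left_mem⟩ g
    · obtain ⟨c, hc⟩ := hex
      exact hT.no_cycle (c := c) ⟨fun g hg => same g c (.inl hg) hc,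
        fun g hg => same g c (.inr hg) hc⟩ hC' hC3
    -- Without linkages the constant is arbitrary and the condition vacuous; `TwoEdges.no_cycle`
    -- finds a linkage itself.
    · push Not at hex
      exact hT.no_cycle (c := 0) ⟨fun g hg => absurd hg (hex g).1,
        fun g hg => absurd hg (hex g).2⟩ hC' hC3
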